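/- There are universal constants $C_0, C_4 > 0$ (which may be taken to be positive integers, and which do not depend on any of the data below) such that the following holds for every real $C_2 \ge C_0$. Let $P$ be a finite set of points in $\mathbb{R}^d$, let $B \supseteq P$ be a convex body (compact and convex), and let $0<\delta<1/10$. Write $\mathbf N(z)$ for the Euclidean distance from $z\in\mathbb{R}^d$ to $P$, and let $\mathbf d_{\mathbf N}(x,y) = \inf_\gamma \int_0^1 \mathbf N(\gamma(t))\,|\gamma'(t)|\,dt$ be the nearest neighbor distance, where the infimum is over all rectifiable (Lipschitz parametrized) paths $\gamma:[0,1]\to\mathbb{R}^d$ from $x$ to $y$. For $p\in P$ let $r_p$ be the inradius of the Voronoi cell of $p$, that is, the radius of the largest ball centered at $p$ contained in the cell (infinite if $P=\{p\}$ and the cell is the whole space), and let $u_p=(1-\delta^{2/3})r_p$; $B(p,r)$ denotes the closed ball. Let $S$ be a (possibly infinite) $\delta$-sample of $D = B\setminus\bigcup_{p\in P} B(p,u_p)$, meaning that $S\subseteq D$ and $\mathrm{dist}(z,S)\le \delta\,\mathbf N(z)$ for all $z\in D\setminus P$, where $\mathrm{dist}(z,\emptyset)=\infty$. Let $\mathcal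 A$ be the weighted undirected graph with vertex set $S\cup P$ and the following edges between distinct vertices: 1. if $s_1,s_2\in S$ and $s_1,s_2\in B(p,r_p)$ for some $p\in P$, an edge $(s_1,s_2)$ of weight $\mathbf d_{\mathbf N}(s_1,s_2)$; 2. otherwise, if $s_1,s_2\in S$ and $|s_1-s_2|\le C_2\,\delta^{2/3}\max(\mathbf N(s_1),\mathbf N(s_2))$, an edge $(s_1,s_2)$ of weight $\max(\mathbf N(s_1),\mathbf N(s_2))\cdot|s_1-s_2|$; 3. if $p\in P$, $s\in S$ and $s\in B(p,r_p)$, an edge $(p,s)$ of weight $\mathbf d_{\mathbf N}(p,s)$. Let $\mathbf d_{\mathcal A}(x,y)$ be the infimum of the lengths (sums of edge weights) of walks from $x$ to $y$ in $\mathcal A$ (infinite if there is none). Then for all $x,y\in P$, $$(1-C_2\delta^{2/3})\,\mathbf d_{\mathbf N}(x,y)\;\le\;\mathbf d_{\mathcal A}(x,y)\;\le\;(1+C_4\delta^{2/3})\,\mathbf d_{\mathbf N}(x,y).$$ -/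

import Mathlib

open scoped ENNReal

noncomputable section

namespace NNMetric

variable {d : ℕ}

/-- The Euclidean distance `N(z)` from `z` to the nearest point of the finite set `P`. -/
def nearest (P : Finset (EuclideanSpace ℝ (Fin d))) (z : EuclideanSpace ℝ (Fin d)) : ℝ :=
  Metric.infDist z (P : Set (EuclideanSpace ℝ (Fin d)))

/-- `γ`, restricted to `[0,1]`, is a (Lipschitz parametrized) rectifiable path from `x` to `y`. -/
def IsPath (γ : ℝ → EuclideanSpace ℝ (Fin d)) (x y : EuclideanSpace ℝ (Fin d)) : Prop :=
  (∃ K, LipschitzOnWith K γ (Set.Icc 0 1)) ∧ γ 0 = x ∧ γ 1 = y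

/-- The nearest neighbor length `∫₀¹ N(γ(t)) |γ'(t)| dt` of a path; a Lipschitz path is
differentiable almost everywhere and the integrand is bounded and measurable. -/
def nnLength (P : Finset (EuclideanSpace ℝ (Fin d))) (γ : ℝ → EuclideanSpace ℝ (Fin d)) : ℝ :=
  ∫ t in (0 : ℝ)..1, nearest P (γ t) * ‖deriv γ t‖

/-- The nearest neighbor distance `N(x,y)`: the infimum of the nearest neighbor lengths of the
paths from `x` to `y`. -/
def nnDist (P : Finset (EuclideanSpace ℝ (Fin d))) (x y : EuclideanSpace ℝ (Fin d)) : ℝ :=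
  sInf {L : ℝ | ∃ γ, IsPath γ x y ∧ L = nnLength P γ}

/-- The (closed) Voronoi cell of the site `p`. -/
def voronoiCell (P : Finset (EuclideanSpace ℝ (Fin d))) (p : EuclideanSpace ℝ (Fin d)) :
    Set (EuclideanSpace ℝ (Fin d)) :=
  {z | ∀ q ∈ P, dist z p ≤ dist z q}

/-- The inradius of the Voronoi cell of `p`: the radius of the largest ball centered at `p` that
is contained in the cell. It is infinite exactly when the cell is the whole space. -/
def inradius (P : Finset (EuclideanSpace ℝ (Fin d))) (p : EuclideanSpace ℝ (Fin d)) : ℝ≥0∞ :=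
  sSup {r : ℝ≥0∞ | Metric.closedEBall p r ⊆ voronoiCell P p}

/-- The in-ball of the Voronoi cell of `p`. -/
def inBall (P : Finset (EuclideanSpace ℝ (Fin d))) (p : EuclideanSpace ℝ (Fin d)) :
    Set (EuclideanSpace ℝ (Fin d)) :=
  Metric.closedEBall p (inradius P p)

/-- The in-ball of `p` shrunk to the radius `u = (1 - δ^(2/3)) r`. -/
def shrunkBall (P : Finset (EuclideanSpace ℝ (Fin d))) (δ : ℝ) (p : EuclideanSpace ℝ (Fin d)) :
    Set (EuclideanSpace ℝ (Fin d)) :=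
  Metric.closedEBall p (ENNReal.ofReal (1 - δ ^ (2 / 3 : ℝ)) * inradius P p)

/-- `T` is a `δ`-sample on the domain `D`: `T ⊆ D`, and `d(z, T) ≤ δ N(z)` for all `z ∈ D \ P`.
(The distance to an empty set is infinite.) -/
def IsDeltaSample (P : Finset (EuclideanSpace ℝ (Fin d))) (δ : ℝ)
    (D T : Set (EuclideanSpace ℝ (Fin d))) : Prop :=
  T ⊆ D ∧ ∀ z ∈ D, z ∉ P → Metric.infEDist z T ≤ ENNReal.ofReal (δ * nearest P z)

/-- The domain `B` with the shrunken in-balls of all sites removed. -/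
def sampleDomain (P : Finset (EuclideanSpace ℝ (Fin d))) (δ : ℝ)
    (B : Set (EuclideanSpace ℝ (Fin d))) : Set (EuclideanSpace ℝ (Fin d)) :=
  B \ ⋃ p ∈ P, shrunkBall P δ p

/-- Edges of type (1): two sample points in a common in-ball. -/
def EdgeOne (P : Finset (EuclideanSpace ℝ (Fin d))) (S : Set (EuclideanSpace ℝ (Fin d)))
    (a b : EuclideanSpace ℝ (Fin d)) : Prop :=
  a ∈ S ∧ b ∈ S ∧ ∃ p ∈ P, a ∈ inBall P p ∧ b ∈ inBall P p

/-- Edges of type (2): two sample points, not joined by an edge of type (1), at Euclidean distance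
at most `C₂ δ^(2/3) max(N(a), N(b))`. -/
def EdgeTwo (P : Finset (EuclideanSpace ℝ (Fin d))) (S : Set (EuclideanSpace ℝ (Fin d)))
    (δ C₂ : ℝ) (a b : EuclideanSpace ℝ (Fin d)) : Prop :=
  a ∈ S ∧ b ∈ S ∧ ¬ EdgeOne P S a b ∧
    dist a b ≤ C₂ * δ ^ (2 / 3 : ℝ) * max (nearest P a) (nearest P b)

/-- Edges of type (3): a site and a sample point in its in-ball. -/
def EdgeThree (P : Finset (EuclideanSpace ℝ (Fin d))) (S : Set (EuclideanSpace ℝ (Fin d)))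
    (a b : EuclideanSpace ℝ (Fin d)) : Prop :=
  a ∈ P ∧ b ∈ S ∧ b ∈ inBall P a

/-- The approximation graph on the vertex set `S ∪ P` (`fromRel` symmetrizes the relation and
drops loops). -/
def approxGraph (P : Finset (EuclideanSpace ℝ (Fin d))) (S : Set (EuclideanSpace ℝ (Fin d)))
    (δ C₂ : ℝ) : SimpleGraph ↥(S ∪ (P : Set (EuclideanSpace ℝ (Fin d)))) :=
  SimpleGraph.fromRel fun a b =>
    EdgeOne P S a b ∨ EdgeTwo P S δ C₂ a b ∨ EdgeThree P S a b

open Classical in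
/-- The weight of an edge: `max(N(a), N(b)) · |a - b|` for type (2), and the nearest neighbor
distance of its endpoints for types (1) and (3). -/
def edgeWeight (P : Finset (EuclideanSpace ℝ (Fin d))) (S : Set (EuclideanSpace ℝ (Fin d)))
    (δ C₂ : ℝ) (a b : EuclideanSpace ℝ (Fin d)) : ℝ :=
  if EdgeTwo P S δ C₂ a b then max (nearest P a) (nearest P b) * dist a b else nnDist P a b

/-- The length of a walk in the approximation graph: the sum of the weights of its edges. -/
def walkLength (P : Finset (EuclideanSpace ℝ (Fin d))) (S : Set (EuclideanSpace ℝ (Fin d)))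
    (δ C₂ : ℝ) {x y : ↥(S ∪ (P : Set (EuclideanSpace ℝ (Fin d))))}
    (w : (approxGraph P S δ C₂).Walk x y) : ℝ :=
  (w.darts.map fun e => edgeWeight P S δ C₂ e.fst e.snd).sum

/-- The shortest-path distance in the approximation graph; it is infinite if there is no walk. -/
def graphDist (P : Finset (EuclideanSpace ℝ (Fin d))) (S : Set (EuclideanSpace ℝ (Fin d)))
    (δ C₂ : ℝ) (x y : ↥(S ∪ (P : Set (EuclideanSpace ℝ (Fin d))))) : ℝ≥0∞ :=
  ⨅ w : (approxGraph P S δ C₂).Walk x y, ENNReal.ofReal (walkLength P S δ C₂ w)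

/-- Reversing a path does not change its nearest neighbor length. -/
theorem exists_reverse (P : Finset (EuclideanSpace ℝ (Fin d)))
    {γ : ℝ → EuclideanSpace ℝ (Fin d)} {x y : EuclideanSpace ℝ (Fin d)} (h : IsPath γ x y) :
    ∃ γ', IsPath γ' y x ∧ nnLength P γ' = nnLength P γ := by
  obtain ⟨⟨K, hK⟩, h0, h1⟩ := h
  refine ⟨fun t => γ (1 - t), ⟨⟨K, ?_⟩, by simpa using h1, by simpa using h0⟩, ?_⟩
  · intro s hs t ht
    have := hK (x := 1 - s) ⟨by linarith [hs.2], by linarith [hs.1]⟩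
      (y := 1 - t) ⟨by linarith [ht.2], by linarith [ht.1]⟩
    simpa using this
  · unfold nnLength
    simp only [deriv_comp_const_sub, norm_neg]
    rw [intervalIntegral.integral_comp_sub_left
      (fun t => nearest P (γ t) * ‖deriv γ t‖) (1 : ℝ)]
    simp

theorem nnDist_comm (P : Finset (EuclideanSpace ℝ (Fin d))) (x y : EuclideanSpace ℝ (Fin d)) :
    nnDist P x y = nnDist P y x := by
  unfold nnDist
  congr 1
  ext L
  constructor <;>
  · rintro ⟨γ, hγ, rfl⟩
    obtain ⟨γ', h', e⟩ := exists_reverse P hγ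
    exact ⟨γ', h', e.symm⟩

/-- The weights do not depend on the order of the endpoints: the graph is undirected. -/
theorem edgeWeight_comm (P : Finset (EuclideanSpace ℝ (Fin d)))
    (S : Set (EuclideanSpace ℝ (Fin d))) (δ C₂ : ℝ) (a b : EuclideanSpace ℝ (Fin d)) :
    edgeWeight P S δ C₂ a b = edgeWeight P S δ C₂ b a := by
  have h1 : EdgeOne P S a b ↔ EdgeOne P S b a := by unfold EdgeOne; grind
  have h2 : EdgeTwo P S δ C₂ a b ↔ EdgeTwo P S δ C₂ b a := by
    unfold EdgeTwo
    rw [h1, dist_comm, max_comm]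
    tauto
  unfold edgeWeight
  rw [nnDist_comm P a b, dist_comm a b, max_comm (nearest P a)]
  by_cases h : EdgeTwo P S δ C₂ a b
  · rw [if_pos h, if_pos (h2.1 h)]
  · rw [if_neg h, if_neg (fun h' => h (h2.2 h'))]

end NNMetric

end

noncomputable section

namespace NNMetric

open MeasureTheory Set Filter Topology
open scoped NNReal RealInnerProductSpace

variable {d : ℕ}

local notation "𝔼" => EuclideanSpace ℝ (Fin d)

/-! ### The distance to the sites -/

/-! Lower bound: put `x = C₂ δ^(2/3)`. The straight segment shows that the nearest neighbor distance
between the ends of a type (2) edge is at most `1 + x/2` times its weight, and `(1 - x)(1 + x/2) ≤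
1`. Edges of the other types carry the exact distance, and the triangle inequality sums the estimate
over a walk (`mul_nnDist_le_walkLength`).

Upper bound: put `h = δ^(1/3)`. Take an almost optimal path between two distinct sites and project
it to `B`; this does not lengthen it, since the sites are fixed (`exists_path_in_convexBody`). Cut
it at points where it has moved by `h N / 2`, with `N` the distance to the sites at the start of the
piece. Such a piece costs at least `3/8 h N²` (`exists_first_exit`), so an error `O(h³ N²)` per
piece is a relative error `O(h²) = O(δ^(2/3))`. There are three sources of error.

Replacing the piece by its chord gains at most `h³ N²` (`chordCost_le_cost`): a path that strays
from its chord is also longer than it.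

Rounding the chord to the sample (`hasWalk_rounding_chord`) uses steps of length about `h² N`, while
sample points are displaced by `O(h³ N)`. Displacement across the chord lengthens a step only to
second order, by a factor `1 + O(h²)`. Displacement along it is of relative size `h`, but telescopes
and leaves only boundary terms `O(h³ N²)`.

There is no sample deep inside the in-balls, so a piece ending there stops at the sphere of radius
`midRad`, and an edge of type (1) or (3) of exact weight takes over (`hasWalk_inBall`,
`hasWalk_site`), again with error `O(h³ N²)`. `exists_step` combines the three. -/

theorem nearest_nonneg (P : Finset 𝔼) (z : 𝔼) : 0 ≤ nearest P z := Metric.infDist_nonneg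

theorem nearest_le_dist {P : Finset 𝔼} {p : 𝔼} (hp : p ∈ P) (z : 𝔼) :
    nearest P z ≤ dist z p := Metric.infDist_le_dist_of_mem (Finset.mem_coe.2 hp)

theorem nearest_le_add (P : Finset 𝔼) (z w : 𝔼) : nearest P z ≤ nearest P w + dist z w :=
  Metric.infDist_le_infDist_add_dist

theorem continuous_nearest (P : Finset 𝔼) : Continuous (nearest P) :=
  Metric.continuous_infDist_pt _

theorem exists_nearest_eq_dist {P : Finset 𝔼} (hP : P.Nonempty) (z : 𝔼) :
    ∃ p ∈ P, nearest P z = dist z p := by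
  obtain ⟨p, hp, h⟩ := (P.finite_toSet.isCompact).exists_infDist_eq_dist
    (Finset.coe_nonempty.2 hP) z
  exact ⟨p, hp, h⟩

theorem nearest_pos {P : Finset 𝔼} (hP : P.Nonempty) {z : 𝔼} (hz : z ∉ P) :
    0 < nearest P z := by
  obtain ⟨p, hp, h⟩ := exists_nearest_eq_dist hP z
  rw [h]
  exact dist_pos.2 fun e => hz (e ▸ hp)

/-! ### The nearest neighbor length of a part of a Lipschitz path -/

/-- The nearest neighbor length of the part of `γ` between the times `s` and `t`. -/
def cost (P : Finset 𝔼) (γ : ℝ → 𝔼) (s t : ℝ) : ℝ :=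
  ∫ u in s..t, nearest P (γ u) * ‖deriv γ u‖

theorem intervalIntegrable_norm_deriv {K : ℝ≥0} {γ : ℝ → 𝔼} (hγ : LipschitzWith K γ) (s t : ℝ) :
    IntervalIntegrable (fun u => ‖deriv γ u‖) volume s t := by
  refine (intervalIntegrable_const (c := (K : ℝ))).mono_fun
    (stronglyMeasurable_deriv γ).norm.aestronglyMeasurable (Eventually.of_forall fun u => ?_)
  simpa using norm_deriv_le_of_lipschitz hγ

theorem intervalIntegrable_cost (P : Finset 𝔼) {K : ℝ≥0} {γ : ℝ → 𝔼} (hγ : LipschitzWith K γ)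
    (s t : ℝ) : IntervalIntegrable (fun u => nearest P (γ u) * ‖deriv γ u‖) volume s t :=
  (intervalIntegrable_norm_deriv hγ s t).continuousOn_mul
    ((continuous_nearest P).comp hγ.continuous).continuousOn

theorem cost_add_cost (P : Finset 𝔼) {K : ℝ≥0} {γ : ℝ → 𝔼} (hγ : LipschitzWith K γ) (r s t : ℝ) :
    cost P γ r s + cost P γ s t = cost P γ r t :=
  intervalIntegral.integral_add_adjacent_intervals (intervalIntegrable_cost P hγ r s)
    (intervalIntegrable_cost P hγ s t)

theorem cost_nonneg (P : Finset 𝔼) (γ : ℝ → 𝔼) {s t : ℝ} (hst : s ≤ t) : 0 ≤ cost P γ s t :=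
  intervalIntegral.integral_nonneg hst fun _ _ => mul_nonneg (nearest_nonneg P _) (norm_nonneg _)

theorem nnLength_nonneg (P : Finset 𝔼) (γ : ℝ → 𝔼) : 0 ≤ nnLength P γ :=
  cost_nonneg P γ zero_le_one

theorem integral_deriv_of_lipschitzWith {K : ℝ≥0} {g : ℝ → ℝ} (hg : LipschitzWith K g) (s t : ℝ) :
    ∫ u in s..t, deriv g u = g t - g s :=
  (hg.lipschitzOnWith.absolutelyContinuousOnInterval).integral_deriv_eq_sub

theorem lipschitzWith_inner_sub {K : ℝ≥0} {γ : ℝ → 𝔼} (hγ : LipschitzWith K γ) (z v : 𝔼) :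
    LipschitzWith (‖v‖₊ * K) (fun s => ⟪v, γ s - z⟫) := by
  refine LipschitzWith.of_dist_le_mul fun s t => ?_
  rw [Real.dist_eq, ← inner_sub_right, sub_sub_sub_cancel_right]
  refine (abs_real_inner_le_norm _ _).trans ?_
  push_cast
  rw [mul_assoc]
  refine mul_le_mul_of_nonneg_left ?_ (norm_nonneg _)
  rw [← dist_eq_norm]
  exact hγ.dist_le_mul s t

theorem hasDerivAt_inner_sub {γ : ℝ → 𝔼} {s : ℝ} (hγ : DifferentiableAt ℝ γ s) (z v : 𝔼) :
    HasDerivAt (fun s => ⟪v, γ s - z⟫) ⟪v, deriv γ s⟫ s :=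
  ((innerSL ℝ v).hasFDerivAt.comp_hasDerivAt s (hγ.hasDerivAt.sub_const z))

/-- The component of the path in the chord direction is a real Lipschitz function, so the
fundamental theorem of calculus and Cauchy–Schwarz apply. -/
theorem dist_le_integral_norm_deriv {K : ℝ≥0} {γ : ℝ → 𝔼} (hγ : LipschitzWith K γ) {s t : ℝ}
    (hst : s ≤ t) : dist (γ s) (γ t) ≤ ∫ u in s..t, ‖deriv γ u‖ := by
  by_cases h0 : γ t - γ s = 0
  · rw [sub_eq_zero.1 h0, dist_self]
    exact intervalIntegral.integral_nonneg hst fun _ _ => norm_nonneg _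
  have hn : 0 < ‖γ t - γ s‖ := norm_pos_iff.2 h0
  set v := (‖γ t - γ s‖)⁻¹ • (γ t - γ s) with hv
  have hv1 : ‖v‖ = 1 := by rw [hv, norm_smul, norm_inv, norm_norm, inv_mul_cancel₀ hn.ne']
  have hlip := lipschitzWith_inner_sub hγ (γ s) v
  have e := integral_deriv_of_lipschitzWith hlip s t
  have e2 : ⟪v, γ t - γ s⟫ - ⟪v, γ s - γ s⟫ = dist (γ s) (γ t) := by
    rw [sub_self, inner_zero_right, sub_zero, hv, real_inner_smul_left, real_inner_self_eq_norm_sq,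
      dist_comm, dist_eq_norm]
    field_simp
  rw [← e2, ← e]
  refine intervalIntegral.integral_mono_ae hst ?_ (intervalIntegrable_norm_deriv hγ s t) ?_
  · refine (intervalIntegrable_const (c := ((‖v‖₊ * K : ℝ≥0) : ℝ))).mono_fun
      (stronglyMeasurable_deriv _).aestronglyMeasurable (Eventually.of_forall fun u => ?_)
    simpa using norm_deriv_le_of_lipschitz hlip
  · filter_upwards [hγ.ae_differentiableAt_real] with u hu
    rw [(hasDerivAt_inner_sub hu (γ s) v).deriv]
    calc ⟪v, deriv γ u⟫ ≤ ‖v‖ * ‖deriv γ u‖ := real_inner_le_norm _ _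
      _ = ‖deriv γ u‖ := by rw [hv1, one_mul]

theorem mul_dist_le_cost (P : Finset 𝔼) {K : ℝ≥0} {γ : ℝ → 𝔼} (hγ : LipschitzWith K γ) {s t c : ℝ}
    (hst : s ≤ t) (hc0 : 0 ≤ c) (hc : ∀ u ∈ Icc s t, c ≤ nearest P (γ u)) :
    c * dist (γ s) (γ t) ≤ cost P γ s t := by
  refine (mul_le_mul_of_nonneg_left (dist_le_integral_norm_deriv hγ hst) hc0).trans ?_
  rw [← intervalIntegral.integral_const_mul]
  refine intervalIntegral.integral_mono_on hst
    ((intervalIntegrable_norm_deriv hγ s t).const_mul c) (intervalIntegrable_cost P hγ s t) ?_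
  exact fun u hu => mul_le_mul_of_nonneg_right (hc u hu) (norm_nonneg _)

/-! ### The nearest neighbor distance -/

theorem bddBelow_nnLength (P : Finset 𝔼) (x y : 𝔼) :
    BddBelow {L : ℝ | ∃ γ, IsPath γ x y ∧ L = nnLength P γ} :=
  ⟨0, by rintro _ ⟨γ, -, rfl⟩; exact nnLength_nonneg P γ⟩

theorem nnDist_nonneg (P : Finset 𝔼) (x y : 𝔼) : 0 ≤ nnDist P x y :=
  Real.sInf_nonneg (by rintro _ ⟨γ, -, rfl⟩; exact nnLength_nonneg P γ)

theorem nnDist_le_nnLength (P : Finset 𝔼) {γ : ℝ → 𝔼} {x y : 𝔼} (h : IsPath γ x y) :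
    nnDist P x y ≤ nnLength P γ :=
  csInf_le (bddBelow_nnLength P x y) ⟨γ, h, rfl⟩

theorem isPath_lineMap (x y : 𝔼) : IsPath (AffineMap.lineMap x y : ℝ → 𝔼) x y :=
  ⟨⟨_, (lipschitzWith_lineMap x y).lipschitzOnWith⟩, by simp, by simp⟩

theorem nnDist_le_cost (P : Finset 𝔼) {K : ℝ≥0} {γ : ℝ → 𝔼} (hγ : LipschitzWith K γ) {s t : ℝ}
    (hst : s ≤ t) : nnDist P (γ s) (γ t) ≤ cost P γ s t := by
  set c := t - s with hc
  have hc0 : 0 ≤ c := sub_nonneg.2 hst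
  have hp : IsPath (fun u => γ (c * u + s)) (γ s) (γ t) := by
    refine ⟨⟨K * ‖c‖₊, (LipschitzWith.of_dist_le_mul fun a b => ?_).lipschitzOnWith⟩, by simp,
      by simp [hc]⟩
    refine (hγ.dist_le_mul _ _).trans (le_of_eq ?_)
    rw [Real.dist_eq, Real.dist_eq, add_sub_add_right_eq_sub, ← mul_sub, abs_mul]
    push_cast
    rw [Real.norm_eq_abs, mul_assoc]
  refine (nnDist_le_nnLength P hp).trans (le_of_eq ?_)
  have hd : ∀ u, deriv (fun u => γ (c * u + s)) u = c • deriv γ (c * u + s) := by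
    intro u
    rw [deriv_comp_mul_left c (fun u => γ (u + s)) u, deriv_comp_add_const]
  unfold nnLength cost
  simp only [hd, norm_smul, Real.norm_eq_abs, abs_of_nonneg hc0]
  have := intervalIntegral.smul_integral_comp_mul_add (a := 0) (b := 1)
    (fun u => nearest P (γ u) * ‖deriv γ u‖) c s
  simp only [mul_zero, zero_add, mul_one, smul_eq_mul, hc, sub_add_cancel] at this
  rw [← this, ← intervalIntegral.integral_const_mul]
  congr 1
  ext u
  ring

/-- A path on `[0,1]` may be taken constant outside of `[0,1]`. -/
theorem exists_lipschitzWith_clamp (P : Finset 𝔼) {γ : ℝ → 𝔼} {x y : 𝔼} (h : IsPath γ x y) :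
    ∃ (K : ℝ≥0) (γ' : ℝ → 𝔼), LipschitzWith K γ' ∧ (∀ u ≤ 0, γ' u = x) ∧ (∀ u, 1 ≤ u → γ' u = y) ∧
      cost P γ' 0 1 = nnLength P γ := by
  obtain ⟨⟨K, hK⟩, h0, h1⟩ := h
  refine ⟨K * 1, IccExtend zero_le_one ((Icc (0 : ℝ) 1).domRestrict γ), ?_, ?_, ?_, ?_⟩
  · exact (lipschitzOnWith_iff_restrict.1 hK).comp (LipschitzWith.projIcc _)
  · intro u hu
    rw [IccExtend_of_le_left _ _ hu]
    exact h0
  · intro u hu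
    rw [IccExtend_of_right_le _ _ hu]
    exact h1
  · refine intervalIntegral.integral_congr_ae ?_
    have h1 : ∀ᵐ u : ℝ, u ≠ 1 := by simp [ae_iff, measure_singleton]
    filter_upwards [h1] with u hu1 hu
    rw [uIoc_of_le zero_le_one] at hu
    have hm : u ∈ Ioo (0 : ℝ) 1 := ⟨hu.1, lt_of_le_of_ne hu.2 hu1⟩
    have he : IccExtend zero_le_one ((Icc (0 : ℝ) 1).domRestrict γ) =ᶠ[𝓝 u] γ := by
      filter_upwards [Ioo_mem_nhds hm.1 hm.2] with v hv
      rw [IccExtend_of_mem _ _ (Ioo_subset_Icc_self hv)]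
      rfl
    rw [he.deriv_eq, he.eq_of_nhds]

theorem nnDist_le_of_paths (P : Finset 𝔼) {γ₁ γ₂ : ℝ → 𝔼} {x y z : 𝔼} (h₁ : IsPath γ₁ x y)
    (h₂ : IsPath γ₂ y z) : nnDist P x z ≤ nnLength P γ₁ + nnLength P γ₂ := by
  obtain ⟨K₁, g₁, hg₁, l₁, r₁, e₁⟩ := exists_lipschitzWith_clamp P h₁
  obtain ⟨K₂, g₂, hg₂, l₂, r₂, e₂⟩ := exists_lipschitzWith_clamp P h₂
  -- Concatenation without a case split: `g₂ (u - 1) = y` for `u ≤ 1` and `g₁ u = y` for `u ≥ 1`.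
  -- The Lipschitz bound is then immediate.
  set g : ℝ → 𝔼 := fun u => g₁ u + g₂ (u - 1) - y with hg
  have hlip : LipschitzWith (K₁ + K₂) g := by
    refine LipschitzWith.of_dist_le_mul fun a b => ?_
    have e : dist (g a) (g b) ≤ dist (g₁ a) (g₁ b) + dist (g₂ (a - 1)) (g₂ (b - 1)) := by
      rw [hg]
      simp only [dist_sub_right]
      exact dist_add_add_le _ _ _ _
    refine e.trans ?_
    have := hg₁.dist_le_mul a b
    have := hg₂.dist_le_mul (a - 1) (b - 1)
    rw [dist_sub_right] at this
    push_cast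
    linarith
  have c₁ : cost P g 0 1 = cost P g₁ 0 1 := by
    refine intervalIntegral.integral_congr_ae ?_
    have h1 : ∀ᵐ u : ℝ, u ≠ 1 := by simp [ae_iff, measure_singleton]
    filter_upwards [h1] with u hu1 hu
    rw [uIoc_of_le zero_le_one] at hu
    have he : g =ᶠ[𝓝 u] g₁ := by
      filter_upwards [Iio_mem_nhds (lt_of_le_of_ne hu.2 hu1)] with v hv
      simp [hg, l₂ (v - 1) (by linarith [mem_Iio.1 hv])]
    rw [he.deriv_eq, he.eq_of_nhds]
  have c₂ : cost P g 1 2 = cost P g₂ 0 1 := by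
    have : cost P g 1 2 = cost P (fun u => g₂ (u - 1)) 1 2 := by
      refine intervalIntegral.integral_congr_ae (Eventually.of_forall fun u hu => ?_)
      rw [uIoc_of_le one_le_two] at hu
      have he : g =ᶠ[𝓝 u] fun u => g₂ (u - 1) := by
        filter_upwards [Ioi_mem_nhds hu.1] with v hv
        simp [hg, r₁ v (le_of_lt hv)]
      rw [he.deriv_eq, he.eq_of_nhds]
    rw [this]
    unfold cost
    simp only [deriv_comp_sub_const]
    rw [intervalIntegral.integral_comp_sub_right (fun u => nearest P (g₂ u) * ‖deriv g₂ u‖) (1 : ℝ)]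
    norm_num
  have := nnDist_le_cost P hlip (s := 0) (t := 2) zero_le_two
  rw [← cost_add_cost P hlip 0 1 2, c₁, c₂, e₁, e₂] at this
  have g0 : g 0 = x := by simp [hg, l₁ 0 le_rfl, l₂ (-1) (by norm_num)]
  have g2 : g 2 = z := by simp [hg, r₁ 2 one_le_two, r₂ (2 - 1) (by norm_num)]
  rwa [g0, g2] at this

theorem exists_nnLength_lt (P : Finset 𝔼) (x y : 𝔼) {ε : ℝ} (hε : 0 < ε) :
    ∃ γ, IsPath γ x y ∧ nnLength P γ < nnDist P x y + ε := by
  obtain ⟨_, ⟨γ, hγ, rfl⟩, h⟩ := Real.lt_sInf_add_pos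
    (s := {L : ℝ | ∃ γ, IsPath γ x y ∧ L = nnLength P γ}) ⟨_, _, isPath_lineMap x y, rfl⟩ hε
  exact ⟨γ, hγ, h⟩

theorem nnDist_triangle (P : Finset 𝔼) (x y z : 𝔼) :
    nnDist P x z ≤ nnDist P x y + nnDist P y z := by
  refine le_of_forall_pos_le_add fun ε hε => ?_
  obtain ⟨γ₁, h₁, l₁⟩ := exists_nnLength_lt P x y (half_pos hε)
  obtain ⟨γ₂, h₂, l₂⟩ := exists_nnLength_lt P y z (half_pos hε)
  linarith [nnDist_le_of_paths P h₁ h₂]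

/-- The nearest neighbor distance is at most the nearest neighbor length of the segment. -/
theorem nnDist_le_segment (P : Finset 𝔼) (x y : 𝔼) :
    nnDist P x y ≤ (max (nearest P x) (nearest P y) + dist x y / 2) * dist x y := by
  refine (nnDist_le_nnLength P (isPath_lineMap x y)).trans ?_
  have hd : ∀ u, deriv (AffineMap.lineMap x y : ℝ → 𝔼) u = y - x := fun u => by
    exact AffineMap.hasDerivAt_lineMap.deriv
  unfold nnLength
  simp only [hd]
  have hb : ∀ u ∈ Icc (0 : ℝ) 1, nearest P (AffineMap.lineMap x y u) * ‖y - x‖ ≤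
      (max (nearest P x) (nearest P y) + dist x y / 2) * dist x y := by
    intro u hu
    rw [← dist_eq_norm, dist_comm y x]
    refine mul_le_mul_of_nonneg_right ?_ dist_nonneg
    have a := nearest_le_add P (AffineMap.lineMap x y u) x
    have b := nearest_le_add P (AffineMap.lineMap x y u) y
    rw [dist_lineMap_left, Real.norm_eq_abs, abs_of_nonneg hu.1] at a
    rw [dist_lineMap_right, Real.norm_eq_abs, abs_of_nonneg (sub_nonneg.2 hu.2)] at b
    have := le_max_left (nearest P x) (nearest P y)
    have := le_max_right (nearest P x) (nearest P y)
    have := dist_nonneg (x := x) (y := y)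
    -- Compare with the nearer endpoint, which is at distance at most half the length.
    rcases le_total u (1 / 2) with h | h <;> nlinarith
  have hi : IntervalIntegrable (fun u => nearest P (AffineMap.lineMap x y u) * ‖y - x‖) volume 0 1 := by
    refine Continuous.intervalIntegrable ?_ _ _
    exact ((continuous_nearest P).comp AffineMap.lineMap_continuous).mul continuous_const
  refine (intervalIntegral.integral_mono_on zero_le_one hi intervalIntegrable_const hb).trans ?_
  simp

/-! ### Projecting paths to a convex body -/

/-- This is the nearest-point projection. Adding the variational inequalities at `π x` and `π y`
gives `‖π x - π y‖² ≤ ⟪x - y, π x - π y⟫`. -/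
theorem exists_lipschitzWith_retraction (B : ConvexBody 𝔼) :
    ∃ π : 𝔼 → 𝔼, LipschitzWith 1 π ∧ (∀ x, π x ∈ B) ∧ ∀ x ∈ B, π x = x := by
  have hex : ∀ u : 𝔼, ∃ v ∈ (B : Set 𝔼), ∀ w ∈ (B : Set 𝔼), ⟪u - v, w - v⟫ ≤ 0 := by
    intro u
    obtain ⟨v, hv, h⟩ := exists_norm_eq_iInf_of_complete_convex B.nonempty B.isCompact.isComplete
      B.convex u
    exact ⟨v, hv, (norm_eq_iInf_iff_real_inner_le_zero B.convex hv).1 h⟩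
  choose π hπ hin using hex
  refine ⟨π, LipschitzWith.of_dist_le_mul fun x y => ?_, hπ, fun x hx => ?_⟩
  · have h1 := hin x (π y) (hπ y)
    have h2 := hin y (π x) (hπ x)
    have e : ⟪π x - π y, π x - π y⟫ =
        ⟪x - y, π x - π y⟫ + ⟪x - π x, π y - π x⟫ + ⟪y - π y, π x - π y⟫ := by
      simp only [inner_sub_left, inner_sub_right]
      ring
    have h3 := real_inner_le_norm (x - y) (π x - π y)
    rw [real_inner_self_eq_norm_sq] at e
    rw [NNReal.coe_one, one_mul, dist_eq_norm, dist_eq_norm]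
    by_contra hlt
    push Not at hlt
    nlinarith [norm_nonneg (π x - π y), norm_nonneg (x - y)]
  · have h := hin x x hx
    rw [real_inner_self_eq_norm_sq] at h
    have : ‖x - π x‖ = 0 := by nlinarith [norm_nonneg (x - π x)]
    exact (sub_eq_zero.1 (norm_eq_zero.1 this)).symm

/-- Difference quotients are compared, so `π` need not be differentiable; where the composition is
not, `deriv` is zero by default. -/
theorem norm_deriv_comp_le {π : 𝔼 → 𝔼} (hπ : LipschitzWith 1 π) {γ : ℝ → 𝔼} {u : ℝ}
    (hγ : DifferentiableAt ℝ γ u) : ‖deriv (fun s => π (γ s)) u‖ ≤ ‖deriv γ u‖ := by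
  by_cases hd : DifferentiableAt ℝ (fun s => π (γ s)) u
  · refine le_of_tendsto_of_tendsto (hasDerivAt_iff_tendsto_slope.1 hd.hasDerivAt).norm
      (hasDerivAt_iff_tendsto_slope.1 hγ.hasDerivAt).norm (Eventually.of_forall fun v => ?_)
    simp only [slope_def_module, norm_smul]
    refine mul_le_mul_of_nonneg_left ?_ (norm_nonneg _)
    rw [← dist_eq_norm, ← dist_eq_norm]
    simpa using hπ.dist_le_mul (γ v) (γ u)
  · rw [deriv_zero_of_not_differentiableAt hd, norm_zero]
    exact norm_nonneg _

theorem exists_path_in_convexBody {P : Finset 𝔼} {B : ConvexBody 𝔼} (hB : (P : Set 𝔼) ⊆ B)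
    {γ : ℝ → 𝔼} {x y : 𝔼} (h : IsPath γ x y) (hx : x ∈ P) (hy : y ∈ P) :
    ∃ (K : ℝ≥0) (g : ℝ → 𝔼), LipschitzWith K g ∧ g 0 = x ∧ g 1 = y ∧ (∀ u, g u ∈ (B : Set 𝔼)) ∧
      cost P g 0 1 ≤ nnLength P γ := by
  obtain ⟨K, g, hg, l, r, e⟩ := exists_lipschitzWith_clamp P h
  obtain ⟨π, hπ, hmem, hfix⟩ := exists_lipschitzWith_retraction B
  have hlip : LipschitzWith (1 * K) fun u => π (g u) := hπ.comp hg
  refine ⟨1 * K, fun u => π (g u), hlip, ?_, ?_, fun u => hmem _, ?_⟩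
  · simp only [l 0 le_rfl]
    exact hfix x (hB hx)
  · simp only [r 1 le_rfl]
    exact hfix y (hB hy)
  · rw [← e]
    refine intervalIntegral.integral_mono_ae zero_le_one (intervalIntegrable_cost P hlip 0 1)
      (intervalIntegrable_cost P hg 0 1) ?_
    filter_upwards [hg.ae_differentiableAt_real] with u hu
    refine mul_le_mul ?_ (norm_deriv_comp_le hπ hu) (norm_nonneg _) (nearest_nonneg P _)
    obtain ⟨p, hp, hd⟩ := exists_nearest_eq_dist ⟨x, hx⟩ (g u)
    rw [hd]
    refine (nearest_le_dist hp _).trans ?_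
    have := hπ.dist_le_mul (g u) p
    rwa [hfix p (hB hp), NNReal.coe_one, one_mul] at this

/-! ### A path is hardly cheaper than its chord -/

/-- Here `W` bounds the deviation of a path of length `L` from its chord of length `ℓ`, and `W * L`
is what the deviation can save. If `L ≤ 2ℓ`, AM-GM bounds `W L` by `W² N / (4L) + L³ / N`: the first
term is paid by the excess length, the second is of third order. If `L ≥ 2ℓ`, the excess is at least
`L / 2` and `W ≤ N / 4` suffices. -/
theorem deviation_mul_length_le {N ρ ℓ L W : ℝ} (hN : 0 < N) (hρ : ρ ≤ N / 4) (hℓ : 0 < ℓ)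
    (hℓρ : ℓ ≤ ρ) (hL : ℓ ≤ L) (hW : W ≤ ρ) (hW2 : W ^ 2 ≤ 2 * L * (L - ℓ)) :
    W * L ≤ N / 2 * (L - ℓ) + 8 * ρ ^ 3 / N := by
  have hL0 : 0 < L := hℓ.trans_le hL
  have hρ0 : 0 < ρ := hℓ.trans_le hℓρ
  rcases le_total L (2 * ℓ) with h | h
  · have h1 : W * L ≤ W ^ 2 * N / (4 * L) + L ^ 3 / N := by
      have : W ^ 2 * N / (4 * L) + L ^ 3 / N - W * L = (W * N - 2 * L ^ 2) ^ 2 / (4 * L * N) := by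
        field_simp
        ring
      have h0 : 0 ≤ (W * N - 2 * L ^ 2) ^ 2 / (4 * L * N) := by positivity
      linarith
    have h2 : W ^ 2 * N / (4 * L) ≤ N / 2 * (L - ℓ) := by
      rw [div_le_iff₀ (by positivity)]
      nlinarith
    have h3 : L ^ 3 / N ≤ 8 * ρ ^ 3 / N := by
      refine div_le_div_of_nonneg_right ?_ hN.le
      have : L ^ 3 ≤ (2 * ρ) ^ 3 := pow_le_pow_left₀ hL0.le (by linarith) 3
      nlinarith
    linarith
  · have h1 : W * L ≤ ρ * L := mul_le_mul_of_nonneg_right hW hL0.le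
    have h2 : ρ * L ≤ N / 4 * (2 * (L - ℓ)) :=
      mul_le_mul hρ (by linarith) hL0.le (by linarith)
    have : 0 ≤ 8 * ρ ^ 3 / N := by positivity
    linarith

/-- The nearest neighbor length of the segment from `x` to `y`. -/
def chordCost (P : Finset 𝔼) (x y : 𝔼) : ℝ :=
  (∫ τ in (0 : ℝ)..1, nearest P (AffineMap.lineMap x y τ)) * dist x y

theorem chordCost_eq_integral (P : Finset 𝔼) {z a v : 𝔼} {ℓ : ℝ} (hℓ : 0 ≤ ℓ) (hv : ‖v‖ = 1)
    (ha : a = z + ℓ • v) : chordCost P z a = ∫ x in (0 : ℝ)..ℓ, nearest P (z + x • v) := by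
  have hd : dist z a = ℓ := by
    rw [ha, dist_self_add_right, norm_smul, hv, mul_one, Real.norm_eq_abs, abs_of_nonneg hℓ]
  have := intervalIntegral.smul_integral_comp_mul_left (a := 0) (b := 1)
    (fun x => nearest P (z + x • v)) ℓ
  rw [mul_zero, mul_one, smul_eq_mul] at this
  rw [← this, chordCost, hd, mul_comm]
  congr 2
  ext τ
  rw [ha, AffineMap.lineMap_apply_module', add_sub_cancel_left, smul_smul, mul_comm τ, add_comm]

/-- By Pythagoras the squared deviation is `(dist w z - X) * (dist w z + X)`. The first factor is at
most the excess length, because `X ≥ ℓ - L₂`. -/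
theorem deviation_sq_le {z w v : 𝔼} {ℓ L₁ L₂ : ℝ} (hv : ‖v‖ = 1)
    (h1 : dist w z ≤ L₁) (h2 : dist w (z + ℓ • v) ≤ L₂) :
    dist w (z + ⟪v, w - z⟫ • v) ^ 2 ≤ 2 * (L₁ + L₂) * (L₁ + L₂ - ℓ) ∧
      dist w (z + ⟪v, w - z⟫ • v) ≤ dist w z := by
  set X := ⟪v, w - z⟫ with hX
  have e : dist w (z + X • v) ^ 2 = dist w z ^ 2 - X ^ 2 := by
    rw [dist_eq_norm, dist_eq_norm, ← sub_sub, norm_sub_sq_real, norm_smul, hv, inner_smul_right,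
      real_inner_comm, ← hX, mul_one, Real.norm_eq_abs, sq_abs]
    ring
  have hX1 : X ≤ dist w z := by
    refine (real_inner_le_norm _ _).trans ?_
    rw [hv, one_mul, dist_eq_norm]
  have hX2 : ℓ - X ≤ dist w (z + ℓ • v) := by
    have : ℓ - X = ⟪v, (z + ℓ • v) - w⟫ := by
      rw [hX, show z + ℓ • v - w = ℓ • v - (w - z) by abel, inner_sub_right v (ℓ • v),
        inner_smul_right, real_inner_self_eq_norm_sq, hv]
      ring
    rw [this, dist_comm, dist_eq_norm]
    refine (real_inner_le_norm _ _).trans ?_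
    rw [hv, one_mul]
  have hX3 : |X| ≤ dist w z := by
    refine (abs_real_inner_le_norm _ _).trans ?_
    rw [hv, one_mul, dist_eq_norm]
  have d0 : 0 ≤ dist w z := dist_nonneg
  have d1 : 0 ≤ dist w (z + ℓ • v) := dist_nonneg
  constructor
  · rw [e]
    have a1 : dist w z - X ≤ L₁ + L₂ - ℓ := by linarith
    have a2 : dist w z + X ≤ 2 * (L₁ + L₂) := by linarith
    have a3 : 0 ≤ dist w z + X := by linarith [neg_abs_le X]
    nlinarith
  · refine abs_le_of_sq_le_sq' (by nlinarith) d0 |>.2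

/-- With `X` the coordinate of the path along the chord and `f` the distance to the sites on that
line, `f(X) X'` integrates to the chord cost. Pointwise, `N(γ) ≥ f(X) - W` and `f(X) (‖γ'‖ - X') ≥
N/2 (‖γ'‖ - X')`. Hence the path costs at least the chord plus `N/2 (L - ℓ) - W L`, and
`deviation_mul_length_le` finishes. -/
theorem chordCost_le_cost (P : Finset 𝔼) {K : ℝ≥0} {γ : ℝ → 𝔼} (hγ : LipschitzWith K γ)
    {s t ρ : ℝ} (hst : s ≤ t) (hN : 0 < nearest P (γ s)) (hρ : ρ ≤ nearest P (γ s) / 4)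
    (hstay : ∀ u ∈ Icc s t, dist (γ u) (γ s) ≤ ρ) :
    chordCost P (γ s) (γ t) ≤ cost P γ s t + 8 * ρ ^ 3 / nearest P (γ s) := by
  have hρ0 : 0 ≤ ρ := dist_nonneg.trans (hstay s ⟨le_rfl, hst⟩)
  by_cases hz : dist (γ s) (γ t) = 0
  · rw [chordCost, hz, mul_zero]
    have := cost_nonneg P γ hst
    positivity
  set z := γ s with hzdef
  set N := nearest P z with hNdef
  set ℓ := dist z (γ t) with hℓdef
  have hℓ : 0 < ℓ := lt_of_le_of_ne dist_nonneg (Ne.symm hz)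
  have hℓρ : ℓ ≤ ρ := by
    rw [hℓdef, dist_comm]
    exact hstay t ⟨hst, le_rfl⟩
  set v := ℓ⁻¹ • (γ t - z) with hvdef
  have hv : ‖v‖ = 1 := by
    rw [hvdef, norm_smul, ← dist_eq_norm, dist_comm, ← hℓdef, norm_inv, Real.norm_eq_abs,
      abs_of_pos hℓ, inv_mul_cancel₀ hℓ.ne']
  have ha : γ t = z + ℓ • v := by
    rw [hvdef, smul_smul, mul_inv_cancel₀ hℓ.ne', one_smul]
    abel
  rw [chordCost_eq_integral P hℓ.le hv ha]
  set f : ℝ → ℝ := fun x => nearest P (z + x • v) with hf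
  have hfc : Continuous f := (continuous_nearest P).comp (by fun_prop)
  have hf_near : ∀ x, |x| ≤ ρ → N - ρ ≤ f x ∧ f x ≤ N + ρ := by
    intro x hx
    have hd : dist (z + x • v) z = |x| := by
      rw [dist_self_add_left, norm_smul, hv, mul_one, Real.norm_eq_abs]
    have h1 := nearest_le_add P (z + x • v) z
    have h2 := nearest_le_add P z (z + x • v)
    rw [hd] at h1
    rw [dist_comm, hd] at h2
    exact ⟨by simp only [hf]; linarith, by simp only [hf]; linarith⟩
  set F : ℝ → ℝ := fun x => ∫ y in (0 : ℝ)..x, f y with hF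
  have hFd : ∀ x, HasDerivAt F (f x) x := fun x =>
    intervalIntegral.integral_hasDerivAt_right (hfc.intervalIntegrable _ _)
      (hfc.stronglyMeasurableAtFilter _ _) hfc.continuousAt
  set X : ℝ → ℝ := fun u => ⟪v, γ u - z⟫ with hX
  have hXlip : LipschitzWith (‖v‖₊ * K) X := lipschitzWith_inner_sub hγ z v
  have hXρ : ∀ u ∈ Icc s t, |X u| ≤ ρ := by
    intro u hu
    refine (abs_real_inner_le_norm _ _).trans ?_
    rw [hv, one_mul, ← dist_eq_norm]
    exact hstay u hu
  -- The path may run backwards or overshoot, so `X` ranges over `[-ρ, ρ]` and not only over `[0,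
  -- ℓ]`.
  have hFlip : LipschitzOnWith (N + ρ).toNNReal F (Icc (-ρ) ρ) := by
    refine (convex_Icc _ _).lipschitzOnWith_of_nnnorm_hasDerivWithin_le
      (fun x _ => (hFd x).hasDerivWithinAt) fun x hx => ?_
    have := hf_near x (abs_le.2 hx)
    rw [← NNReal.coe_le_coe, coe_nnnorm, Real.norm_eq_abs,
      abs_of_nonneg (nearest_nonneg P _), Real.coe_toNNReal _ (by linarith)]
    exact this.2
  have hGlip : LipschitzOnWith ((N + ρ).toNNReal * (‖v‖₊ * K)) (F ∘ X) (uIcc s t) := by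
    rw [uIcc_of_le hst]
    exact hFlip.comp hXlip.lipschitzOnWith fun u hu => abs_le.1 (hXρ u hu)
  have hGac := hGlip.absolutelyContinuousOnInterval
  have hXac := (hXlip.lipschitzOnWith (s := uIcc s t)).absolutelyContinuousOnInterval
  have hXs : X s = 0 := by simp [hX, hzdef]
  have hXt : X t = ℓ := by
    simp only [hX]
    rw [ha, add_sub_cancel_left, inner_smul_right, real_inner_self_eq_norm_sq, hv]
    ring
  have hGint : ∫ u in s..t, deriv (F ∘ X) u = F ℓ := by
    rw [hGac.integral_deriv_eq_sub, Function.comp, Function.comp, hXs, hXt]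
    simp [hF]
  have hXint : ∫ u in s..t, deriv X u = ℓ := by
    rw [hXac.integral_deriv_eq_sub, hXs, hXt, sub_zero]
  set L := ∫ u in s..t, ‖deriv γ u‖ with hLdef
  have hLℓ : ℓ ≤ L := dist_le_integral_norm_deriv hγ hst
  set W := min ρ (√(2 * L * (L - ℓ))) with hWdef
  have hL0 : 0 ≤ 2 * L * (L - ℓ) := by
    have := hℓ.le.trans hLℓ
    exact mul_nonneg (by linarith) (by linarith)
  have hdev : ∀ u ∈ Icc s t, dist (γ u) (z + X u • v) ≤ W := by
    intro u hu
    have i1 := dist_le_integral_norm_deriv hγ hu.1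
    have i2 := dist_le_integral_norm_deriv hγ hu.2
    rw [dist_comm] at i1
    rw [ha] at i2
    have i3 := intervalIntegral.integral_add_adjacent_intervals
      (intervalIntegrable_norm_deriv hγ s u) (intervalIntegrable_norm_deriv hγ u t)
    obtain ⟨b1, b2⟩ := deviation_sq_le hv i1 i2
    rw [i3] at b1
    exact le_min (b2.trans (hstay u hu)) (Real.le_sqrt_of_sq_le b1)
  have hW0 : 0 ≤ W := le_min hρ0 (Real.sqrt_nonneg _)
  have hW2 : W ^ 2 ≤ 2 * L * (L - ℓ) := by
    calc W ^ 2 ≤ (√(2 * L * (L - ℓ))) ^ 2 := pow_le_pow_left₀ hW0 (min_le_right _ _) 2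
      _ = _ := Real.sq_sqrt hL0
  have harith := deviation_mul_length_le hN hρ hℓ hℓρ hLℓ (min_le_left _ _) hW2
  have iγ := intervalIntegrable_norm_deriv hγ s t
  have iX := hXac.intervalIntegrable_deriv
  have iG := hGac.intervalIntegrable_deriv
  have key : ∫ u in s..t, (deriv (F ∘ X) u + (N / 2 * (‖deriv γ u‖ - deriv X u) -
      W * ‖deriv γ u‖)) ≤ cost P γ s t := by
    refine intervalIntegral.integral_mono_ae_restrict hst
      (iG.add (((iγ.sub iX).const_mul _).sub (iγ.const_mul _))) (intervalIntegrable_cost P hγ s t) ?_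
    filter_upwards [ae_restrict_of_ae hγ.ae_differentiableAt_real,
      ae_restrict_mem measurableSet_Icc] with u hu hmem
    have hXd : HasDerivAt X ⟪v, deriv γ u⟫ u := hasDerivAt_inner_sub hu z v
    rw [((hFd (X u)).comp u hXd).deriv, hXd.deriv]
    have h1 : ⟪v, deriv γ u⟫ ≤ ‖deriv γ u‖ := by
      refine (real_inner_le_norm _ _).trans ?_
      rw [hv, one_mul]
    have h2 := (hf_near (X u) (hXρ u hmem)).1
    have h3 : f (X u) - W ≤ nearest P (γ u) := by
      have := nearest_le_add P (z + X u • v) (γ u)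
      rw [dist_comm] at this
      have := hdev u hmem
      simp only [hf]
      linarith
    have h4 := mul_le_mul_of_nonneg_right h3 (norm_nonneg (deriv γ u))
    have h5 : 0 ≤ (f (X u) - N / 2) * (‖deriv γ u‖ - ⟪v, deriv γ u⟫) :=
      mul_nonneg (by linarith) (by linarith)
    nlinarith
  rw [intervalIntegral.integral_add iG (((iγ.sub iX).const_mul _).sub (iγ.const_mul _)),
    intervalIntegral.integral_sub ((iγ.sub iX).const_mul _) (iγ.const_mul _),
    intervalIntegral.integral_const_mul, intervalIntegral.integral_const_mul,
    intervalIntegral.integral_sub iγ iX, hGint, hXint] at key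
  simp only [hF] at key
  linarith

/-! ### In-balls -/

theorem inradius_le {P : Finset 𝔼} {p q : 𝔼} (hq : q ∈ P) (hqp : q ≠ p) :
    inradius P p ≤ ENNReal.ofReal (dist p q / 2) := by
  refine sSup_le fun r hr => ?_
  by_contra hlt
  push Not at hlt
  have hD : 0 < dist p q := dist_pos.2 hqp.symm
  -- A radius just past the midpoint, capped at `dist p q` so that the test point stays on the
  -- segment; this also covers `r = ⊤`.
  obtain ⟨c, hc0, hc1, hc⟩ : ∃ c : ℝ, dist p q / 2 < c ∧ c ≤ dist p q ∧ ENNReal.ofReal c ≤ r := by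
    rcases le_total (ENNReal.ofReal (dist p q)) r with h | h
    · exact ⟨dist p q, by linarith, le_rfl, h⟩
    · have hr' : r ≠ ⊤ := ne_top_of_le_ne_top ENNReal.ofReal_ne_top h
      refine ⟨r.toReal, ?_, ENNReal.toReal_le_of_le_ofReal hD.le h, ?_⟩
      · exact (ENNReal.ofReal_lt_iff_lt_toReal (by positivity) hr').1 hlt
      · rw [ENNReal.ofReal_toReal hr']
  set w := AffineMap.lineMap p q (c / dist p q) with hw
  have hc2 : 0 < c / dist p q := div_pos (by linarith) hD
  have hc3 : c / dist p q ≤ 1 := (div_le_one hD).2 hc1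
  have hwp : dist w p = c := by
    rw [hw, dist_lineMap_left, Real.norm_eq_abs, abs_of_pos hc2, div_mul_cancel₀ _ hD.ne']
  have hwq : dist w q = dist p q - c := by
    rw [hw, dist_lineMap_right, Real.norm_eq_abs, abs_of_nonneg (by linarith), sub_mul,
      div_mul_cancel₀ _ hD.ne', one_mul]
  have hmem : w ∈ Metric.closedEBall p r := by
    rw [Metric.mem_closedEBall, edist_dist, hwp]
    exact hc
  have := hr hmem q hq
  rw [hwp, hwq] at this
  linarith

theorem inradius_pos (P : Finset 𝔼) (p : 𝔼) : 0 < inradius P p := by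
  obtain ⟨ε, hε, h⟩ : ∃ ε : ℝ, 0 < ε ∧ ∀ q ∈ P, q ≠ p → 2 * ε ≤ dist p q := by
    rcases (P.erase p).eq_empty_or_nonempty with h | h
    · refine ⟨1, one_pos, fun q hq hqp => ?_⟩
      have : q ∈ P.erase p := Finset.mem_erase.2 ⟨hqp, hq⟩
      rw [h] at this
      simp at this
    · refine ⟨nearest (P.erase p) p / 2, half_pos (nearest_pos h (by simp)), fun q hq hqp => ?_⟩
      have := nearest_le_dist (Finset.mem_erase.2 ⟨hqp, hq⟩) p
      linarith
  refine (ENNReal.ofReal_pos.2 hε).trans_le (le_sSup fun z hz q hq => ?_)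
  rw [Metric.mem_closedEBall, edist_dist, ENNReal.ofReal_le_ofReal_iff hε.le] at hz
  by_cases hqp : q = p
  · rw [hqp]
  · have := h q hq hqp
    have := dist_triangle_left p q z
    linarith

/-- The inradius of the Voronoi cell as a real number. -/
def rad (P : Finset 𝔼) (p : 𝔼) : ℝ := (inradius P p).toReal

theorem inradius_eq {P : Finset 𝔼} {p q : 𝔼} (hq : q ∈ P) (hqp : q ≠ p) :
    inradius P p = ENNReal.ofReal (rad P p) :=
  (ENNReal.ofReal_toReal (ne_top_of_le_ne_top ENNReal.ofReal_ne_top (inradius_le hq hqp))).symm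

theorem two_mul_rad_le {P : Finset 𝔼} {p q : 𝔼} (hq : q ∈ P) (hqp : q ≠ p) :
    2 * rad P p ≤ dist p q := by
  have := ENNReal.toReal_le_of_le_ofReal (by positivity) (inradius_le hq hqp)
  rw [rad]
  linarith

theorem rad_pos {P : Finset 𝔼} {p q : 𝔼} (hq : q ∈ P) (hqp : q ≠ p) : 0 < rad P p :=
  ENNReal.toReal_pos (inradius_pos P p).ne'
    (ne_top_of_le_ne_top ENNReal.ofReal_ne_top (inradius_le hq hqp))

theorem inBall_eq {P : Finset 𝔼} {p q : 𝔼} (hq : q ∈ P) (hqp : q ≠ p) :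
    inBall P p = Metric.closedBall p (rad P p) := by
  rw [inBall, inradius_eq hq hqp, Metric.closedEBall_ofReal (rad_pos hq hqp).le]

theorem shrunkBall_eq {P : Finset 𝔼} {p q : 𝔼} {δ : ℝ} (hδ : δ ^ (2 / 3 : ℝ) ≤ 1) (hq : q ∈ P)
    (hqp : q ≠ p) :
    shrunkBall P δ p = Metric.closedBall p ((1 - δ ^ (2 / 3 : ℝ)) * rad P p) := by
  have h : 0 ≤ 1 - δ ^ (2 / 3 : ℝ) := sub_nonneg.2 hδ
  rw [shrunkBall, inradius_eq hq hqp, ← ENNReal.ofReal_mul h,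
    Metric.closedEBall_ofReal (mul_nonneg h (rad_pos hq hqp).le)]

theorem nearest_eq_dist {P : Finset 𝔼} {p z : 𝔼} (hp : p ∈ P) (hz : dist z p ≤ rad P p) :
    nearest P z = dist z p := by
  refine le_antisymm (nearest_le_dist hp z) ?_
  obtain ⟨q, hq, h⟩ := exists_nearest_eq_dist ⟨p, hp⟩ z
  rw [h]
  by_cases hqp : q = p
  · rw [hqp]
  · have := two_mul_rad_le hq hqp
    have := dist_triangle_left p q z
    linarith

/-! ### Walks in the approximation graph -/

/-- There is a walk from `a` to `b` of length at most `L`. -/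
def HasWalk (P : Finset 𝔼) (S : Set 𝔼) (δ C₂ : ℝ) (a b : 𝔼) (L : ℝ) : Prop :=
  ∃ (ha : a ∈ S ∪ (P : Set 𝔼)) (hb : b ∈ S ∪ (P : Set 𝔼))
    (w : (approxGraph P S δ C₂).Walk ⟨a, ha⟩ ⟨b, hb⟩), walkLength P S δ C₂ w ≤ L

section Walks

variable {P : Finset (EuclideanSpace ℝ (Fin d))} {S : Set (EuclideanSpace ℝ (Fin d))}
  {δ C₂ L L' : ℝ} {a b c : EuclideanSpace ℝ (Fin d)}

theorem HasWalk.mono (h : HasWalk P S δ C₂ a b L) (hL : L ≤ L') : HasWalk P S δ C₂ a b L' := by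
  obtain ⟨ha, hb, w, hw⟩ := h
  exact ⟨ha, hb, w, hw.trans hL⟩

theorem HasWalk.refl (ha : a ∈ S) : HasWalk P S δ C₂ a a 0 :=
  ⟨Or.inl ha, Or.inl ha, SimpleGraph.Walk.nil, by simp [walkLength]⟩

theorem HasWalk.trans (h : HasWalk P S δ C₂ a b L) (h' : HasWalk P S δ C₂ b c L') :
    HasWalk P S δ C₂ a c (L + L') := by
  obtain ⟨ha, hb, w, hw⟩ := h
  obtain ⟨_, hc, w', hw'⟩ := h'
  refine ⟨ha, hc, w.append w', ?_⟩
  simp only [walkLength, SimpleGraph.Walk.darts_append, List.map_append, List.sum_append] at *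
  linarith

theorem HasWalk.of_adj {ha : a ∈ S ∪ (P : Set 𝔼)} {hb : b ∈ S ∪ (P : Set 𝔼)}
    (h : (approxGraph P S δ C₂).Adj ⟨a, ha⟩ ⟨b, hb⟩) (hL : edgeWeight P S δ C₂ a b ≤ L) :
    HasWalk P S δ C₂ a b L :=
  ⟨ha, hb, h.toWalk, by simpa [walkLength] using hL⟩

theorem HasWalk.symm (h : HasWalk P S δ C₂ a b L) : HasWalk P S δ C₂ b a L := by
  obtain ⟨ha, hb, w, hw⟩ := h
  refine ⟨hb, ha, w.reverse, ?_⟩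
  refine le_trans (le_of_eq ?_) hw
  simp only [walkLength, SimpleGraph.Walk.darts_reverse, List.map_reverse, List.map_map,
    List.sum_reverse]
  congr 1
  refine List.map_congr_left fun e _ => ?_
  exact edgeWeight_comm P S δ C₂ _ _

theorem HasWalk.of_inBall {p : 𝔼} (hp : p ∈ P) (ha : a ∈ S) (hb : b ∈ S) (ha' : a ∈ inBall P p)
    (hb' : b ∈ inBall P p) : HasWalk P S δ C₂ a b (nnDist P a b) := by
  by_cases hab : a = b
  · subst hab
    exact (HasWalk.refl ha).mono (nnDist_nonneg P a a)
  have h1 : EdgeOne P S a b := ⟨ha, hb, p, hp, ha', hb'⟩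
  refine HasWalk.of_adj (ha := Or.inl ha) (hb := Or.inl hb) ?_ (le_of_eq ?_)
  · exact (SimpleGraph.fromRel_adj _ _ _).2 ⟨fun e => hab (congrArg Subtype.val e), Or.inl (Or.inl h1)⟩
  · rw [edgeWeight, if_neg fun h => h.2.2.1 h1]

theorem HasWalk.of_site (hSP : ∀ q ∈ P, q ∉ S) (ha : a ∈ P) (hb : b ∈ S)
    (hb' : b ∈ inBall P a) : HasWalk P S δ C₂ a b (nnDist P a b) := by
  refine HasWalk.of_adj (ha := Or.inr ha) (hb := Or.inl hb) ?_ (le_of_eq ?_)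
  · refine (SimpleGraph.fromRel_adj _ _ _).2 ⟨fun e => hSP a ha ?_, Or.inl (Or.inr (Or.inr ⟨ha, hb, hb'⟩))⟩
    have : a = b := congrArg Subtype.val e
    rwa [this]
  · rw [edgeWeight, if_neg fun h => hSP a ha h.1]

/-- Two close points may share an in-ball, and then their edge weighs the exact distance. The extra
`dist a b / 2` makes one bound serve both types of edge. -/
theorem HasWalk.of_dist_le (ha : a ∈ S) (hb : b ∈ S)
    (h : dist a b ≤ C₂ * δ ^ (2 / 3 : ℝ) * max (nearest P a) (nearest P b)) :
    HasWalk P S δ C₂ a b ((max (nearest P a) (nearest P b) + dist a b / 2) * dist a b) := by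
  by_cases hone : EdgeOne P S a b
  · obtain ⟨-, -, p, hp, ha', hb'⟩ := hone
    exact (HasWalk.of_inBall hp ha hb ha' hb').mono (nnDist_le_segment P a b)
  by_cases hab : a = b
  · subst hab
    exact (HasWalk.refl ha).mono (by simp)
  have h2 : EdgeTwo P S δ C₂ a b := ⟨ha, hb, hone, h⟩
  refine HasWalk.of_adj (ha := Or.inl ha) (hb := Or.inl hb) ?_ ?_
  · exact (SimpleGraph.fromRel_adj _ _ _).2
      ⟨fun e => hab (congrArg Subtype.val e), Or.inl (Or.inr (Or.inl h2))⟩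
  · rw [edgeWeight, if_pos h2]
    have := dist_nonneg (x := a) (y := b)
    nlinarith

theorem graphDist_le {x y : ↥(S ∪ (P : Set 𝔼))} (h : HasWalk P S δ C₂ x y L) :
    graphDist P S δ C₂ x y ≤ ENNReal.ofReal L := by
  obtain ⟨_, _, w, hw⟩ := h
  exact (iInf_le _ w).trans (ENNReal.ofReal_le_ofReal hw)

/-! ### The lower bound -/

theorem mul_nnDist_le_edgeWeight (h0 : 0 ≤ 1 - C₂ * δ ^ (2 / 3 : ℝ))
    (h1 : 0 ≤ C₂ * δ ^ (2 / 3 : ℝ)) (a b : 𝔼) :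
    (1 - C₂ * δ ^ (2 / 3 : ℝ)) * nnDist P a b ≤ edgeWeight P S δ C₂ a b := by
  rw [edgeWeight]
  split_ifs with h
  · have hseg := nnDist_le_segment P a b
    have hd := h.2.2.2
    set M := max (nearest P a) (nearest P b)
    set x := C₂ * δ ^ (2 / 3 : ℝ)
    have hl := dist_nonneg (x := a) (y := b)
    have hM : 0 ≤ M := (nearest_nonneg P a).trans (le_max_left _ _)
    calc (1 - x) * nnDist P a b ≤ (1 - x) * ((M + dist a b / 2) * dist a b) :=
          mul_le_mul_of_nonneg_left hseg h0
      _ ≤ (1 - x) * ((M + x * M / 2) * dist a b) := by gcongr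
      _ = M * dist a b - (x / 2 + x ^ 2 / 2) * (M * dist a b) := by ring
      _ ≤ M * dist a b := by
        have : 0 ≤ (x / 2 + x ^ 2 / 2) * (M * dist a b) := by positivity
        linarith
  · have := nnDist_nonneg P a b
    nlinarith

theorem nnDist_self (P : Finset 𝔼) (x : 𝔼) : nnDist P x x = 0 := by
  refine le_antisymm ?_ (nnDist_nonneg P x x)
  simpa using nnDist_le_segment P x x

theorem mul_nnDist_le_walkLength (h0 : 0 ≤ 1 - C₂ * δ ^ (2 / 3 : ℝ))
    (h1 : 0 ≤ C₂ * δ ^ (2 / 3 : ℝ)) {x y : ↥(S ∪ (P : Set 𝔼))}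
    (w : (approxGraph P S δ C₂).Walk x y) :
    (1 - C₂ * δ ^ (2 / 3 : ℝ)) * nnDist P x y ≤ walkLength P S δ C₂ w := by
  induction w with
  | nil => simp [walkLength, nnDist_self]
  | @cons u v w hadj p ih =>
    have e : walkLength P S δ C₂ (SimpleGraph.Walk.cons hadj p) =
        edgeWeight P S δ C₂ u v + walkLength P S δ C₂ p := by
      simp [walkLength]
    rw [e]
    have h2 := mul_nnDist_le_edgeWeight (P := P) (S := S) h0 h1 (u : 𝔼) v
    have h3 := mul_le_mul_of_nonneg_left (nnDist_triangle P (u : 𝔼) v w) h0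
    linarith

theorem ofReal_mul_nnDist_le_graphDist (h1 : 0 ≤ C₂ * δ ^ (2 / 3 : ℝ))
    (x y : ↥(S ∪ (P : Set 𝔼))) :
    ENNReal.ofReal ((1 - C₂ * δ ^ (2 / 3 : ℝ)) * nnDist P x y) ≤ graphDist P S δ C₂ x y := by
  rcases le_total 0 (1 - C₂ * δ ^ (2 / 3 : ℝ)) with h0 | h0
  · exact le_iInf fun w => ENNReal.ofReal_le_ofReal (mul_nnDist_le_walkLength h0 h1 w)
  -- For large `C₂` the factor is not positive and the bound is trivial.
  · rw [ENNReal.ofReal_of_nonpos (mul_nonpos_of_nonpos_of_nonneg h0 (nnDist_nonneg P x y))]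
    exact zero_le

end Walks

/-! ### Following a segment through the sample -/

/-- `σ` moves the points of `G` to nearby points of `S`. -/
def IsRounding (P : Finset 𝔼) (S G : Set 𝔼) (h : ℝ) (σ : 𝔼 → 𝔼) : Prop :=
  ∀ w ∈ G, σ w ∈ S ∧ dist (σ w) w ≤ 3 / 2 * h ^ 3 * nearest P w

theorem dist_rounding_le {P : Finset (EuclideanSpace ℝ (Fin d))}
    {S G : Set (EuclideanSpace ℝ (Fin d))} {h N : ℝ} {σ : 𝔼 → 𝔼} (hσ : IsRounding P S G h σ)
    (h0 : 0 < h) (h1 : h ≤ 93 / 200) {w : 𝔼} (hw : w ∈ G) (hN : 0 ≤ N)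
    (hwN : nearest P w ≤ N + h * N / 2) : dist (σ w) w ≤ 2 * h ^ 3 * N := by
  refine (hσ w hw).2.trans ?_
  have h3 : 0 < h ^ 3 := by positivity
  have : nearest P w ≤ 4 / 3 * N := by nlinarith
  nlinarith

/-- The source of the constant 8: the rounded points are at most `4 h² N` apart, and the distance to
the sites is at least `N / 2` there. -/
theorem hasWalk_rounding_of_dist_le {P : Finset (EuclideanSpace ℝ (Fin d))}
    {S G : Set (EuclideanSpace ℝ (Fin d))} {h N δ C₂ : ℝ} {σ : 𝔼 → 𝔼}
    (hσ : IsRounding P S G h σ) (h0 : 0 < h) (h1 : h ≤ 93 / 200) (hδ : δ ^ (2 / 3 : ℝ) = h ^ 2)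
    (hC : 8 ≤ C₂) {w w' : 𝔼} (hw : w ∈ G) (hw' : w' ∈ G) (hN : 0 < N)
    (h2 : N - h * N / 2 ≤ nearest P w) (h3 : nearest P w ≤ N + h * N / 2)
    (h4 : nearest P w' ≤ N + h * N / 2) (h5 : dist w w' ≤ 2 * h ^ 2 * N) :
    HasWalk P S δ C₂ (σ w) (σ w') ((nearest P w + 5 * h ^ 2 * N) * dist (σ w) (σ w')) := by
  have e := dist_rounding_le hσ h0 h1 hw hN.le h3
  have e' := dist_rounding_le hσ h0 h1 hw' hN.le h4
  have hv : dist (σ w) (σ w') ≤ dist w w' + 4 * h ^ 3 * N := by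
    have a := dist_triangle4_right (σ w) (σ w') w w'
    have b := dist_triangle4 (σ w) w w' (σ w')
    rw [dist_comm w' (σ w')] at b
    linarith
  have hh : h ^ 3 * N ≤ 1 / 2 * h ^ 2 * N := by
    have : 0 < h ^ 2 * N := by positivity
    nlinarith
  have hv4 : dist (σ w) (σ w') ≤ 4 * h ^ 2 * N := by linarith
  have hmaxlow : N / 2 ≤ max (nearest P (σ w)) (nearest P (σ w')) := by
    refine le_trans ?_ (le_max_left _ _)
    have := nearest_le_add P w (σ w)
    rw [dist_comm] at this
    have h33 : h ^ 3 ≤ (93 / 200) ^ 3 := pow_le_pow_left₀ h0.le h1 3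
    norm_num at h33
    nlinarith
  have hmaxup : max (nearest P (σ w)) (nearest P (σ w')) ≤ nearest P w + 3 * h ^ 2 * N := by
    have a := nearest_le_add P (σ w) w
    have b := nearest_le_add P (σ w') w'
    have c := nearest_le_add P w' w
    rw [dist_comm w' w] at c
    refine max_le ?_ ?_
    · have : 0 < h ^ 2 * N := by positivity
      linarith
    · linarith
  refine (HasWalk.of_dist_le (hσ w hw).1 (hσ w' hw').1 ?_).mono ?_
  · rw [hδ]
    calc dist (σ w) (σ w') ≤ 8 * h ^ 2 * (N / 2) := by linarith
      _ ≤ C₂ * h ^ 2 * max (nearest P (σ w)) (nearest P (σ w')) := by gcongr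
  · refine mul_le_mul_of_nonneg_right ?_ dist_nonneg
    linarith

/-- The new step is `A • u + g` with `‖g‖ ≤ 4 h A`, so its length is `A + ⟪u, g⟫` up to `8 h² A`.
The term in `⟪u, g⟫` is too large to be estimated; it is kept as a difference of the same expression
at both ends, so that it telescopes. -/
theorem hasWalk_rounding_step {P : Finset (EuclideanSpace ℝ (Fin d))}
    {S G : Set (EuclideanSpace ℝ (Fin d))} {h N δ C₂ A : ℝ} {σ : 𝔼 → 𝔼}
    (hσ : IsRounding P S G h σ) (h0 : 0 < h) (h1 : h ≤ 93 / 200) (hδ : δ ^ (2 / 3 : ℝ) = h ^ 2)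
    (hC : 8 ≤ C₂) {w u : 𝔼} (hu : ‖u‖ = 1) (hw : w ∈ G) (hw' : w + A • u ∈ G) (hN : 0 < N)
    (h2 : N - h * N / 2 ≤ nearest P w) (h3 : nearest P w ≤ N + h * N / 2)
    (h4 : nearest P (w + A • u) ≤ N + h * N / 2) (hA : h ^ 2 * N ≤ A) (hA' : A ≤ 2 * h ^ 2 * N) :
    HasWalk P S δ C₂ (σ w) (σ (w + A • u))
      (nearest P w * A + (nearest P (w + A • u) * ⟪u, σ (w + A • u) - (w + A • u)⟫ -
        nearest P w * ⟪u, σ w - w⟫) + 26 * h ^ 2 * N * A) := by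
  have hA0 : 0 < A := lt_of_lt_of_le (by positivity) hA
  set w' := w + A • u with hw'def
  have hd : dist w w' = A := by
    rw [hw'def, dist_self_add_right, norm_smul, hu, mul_one, Real.norm_eq_abs, abs_of_pos hA0]
  refine (hasWalk_rounding_of_dist_le hσ h0 h1 hδ hC hw hw' hN h2 h3 h4 (hd.le.trans hA')).mono ?_
  have e := dist_rounding_le hσ h0 h1 hw hN.le h3
  have e' := dist_rounding_le hσ h0 h1 hw' hN.le h4
  rw [dist_eq_norm] at e e'
  set g := (σ w' - w') - (σ w - w) with hg
  have hgn : ‖g‖ ≤ 4 * h ^ 3 * N := by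
    have := norm_sub_le (σ w' - w') (σ w - w)
    rw [← hg] at this
    linarith
  have hgA : ‖g‖ ≤ 4 * h * A := by
    have : h * (h ^ 2 * N) ≤ h * A := mul_le_mul_of_nonneg_left hA h0.le
    nlinarith
  set V := dist (σ w) (σ w') with hV
  have hVe : V = ‖A • u + g‖ := by
    rw [hV, dist_comm, dist_eq_norm, hg, hw'def]
    congr 1
    abel
  have hV3 : V ≤ 3 * A := by
    rw [hVe]
    refine (norm_add_le _ _).trans ?_
    rw [norm_smul, hu, mul_one, Real.norm_eq_abs, abs_of_pos hA0]
    nlinarith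
  have hVq : V ≤ A + ⟪u, g⟫ + 8 * h ^ 2 * A := by
    have hsq : V ^ 2 = A ^ 2 + 2 * A * ⟪u, g⟫ + ‖g‖ ^ 2 := by
      rw [hVe, norm_add_sq_real, norm_smul, hu, real_inner_smul_left, mul_one, Real.norm_eq_abs,
        sq_abs]
      ring
    have hg2 : ‖g‖ ^ 2 ≤ (4 * h * A) ^ 2 := pow_le_pow_left₀ (norm_nonneg _) hgA 2
    -- A square root is avoided through `2 A V ≤ A² + V²`.
    have : 2 * A * V ≤ 2 * A * (A + ⟪u, g⟫ + 8 * h ^ 2 * A) := by nlinarith [sq_nonneg (V - A)]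
    exact le_of_mul_le_mul_left this (by positivity)
  have hq : ⟪u, g⟫ = ⟪u, σ w' - w'⟫ - ⟪u, σ w - w⟫ := by rw [hg, inner_sub_right]
  have hlip : |nearest P w - nearest P w'| ≤ A := by
    have a := nearest_le_add P w w'
    have b := nearest_le_add P w' w
    rw [dist_comm w' w] at b
    rw [hd] at a b
    exact abs_le.2 ⟨by linarith, by linarith⟩
  have hie : |⟪u, σ w' - w'⟫| ≤ 2 * h ^ 3 * N := by
    refine (abs_real_inner_le_norm _ _).trans ?_
    rw [hu, one_mul]
    exact e'
  have hprod : (nearest P w - nearest P w') * ⟪u, σ w' - w'⟫ ≤ h ^ 2 * N * A := by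
    refine (le_abs_self _).trans ?_
    rw [abs_mul]
    refine (mul_le_mul hlip hie (abs_nonneg _) hA0.le).trans ?_
    have : 0 < A * h ^ 2 * N := by positivity
    nlinarith
  have hNw := nearest_nonneg P w
  have hNw2 : nearest P w ≤ 5 / 4 * N := by nlinarith
  have a1 : nearest P w * V ≤ nearest P w * (A + ⟪u, g⟫ + 8 * h ^ 2 * A) :=
    mul_le_mul_of_nonneg_left hVq hNw
  have a2 : nearest P w * (8 * h ^ 2 * A) ≤ 5 / 4 * N * (8 * h ^ 2 * A) :=
    mul_le_mul_of_nonneg_right hNw2 (by positivity)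
  have a3 : 5 * h ^ 2 * N * V ≤ 5 * h ^ 2 * N * (3 * A) :=
    mul_le_mul_of_nonneg_left hV3 (by positivity)
  rw [hq] at a1
  nlinarith

theorem integral_nearest_ge (P : Finset 𝔼) (z u : 𝔼) (hu : ‖u‖ = 1) {s A : ℝ} (hA : 0 ≤ A) :
    nearest P (z + s • u) * A - A ^ 2 ≤ ∫ x in s..(s + A), nearest P (z + x • u) := by
  have hc : Continuous fun x : ℝ => nearest P (z + x • u) :=
    (continuous_nearest P).comp (by fun_prop)
  have := intervalIntegral.integral_mono_on (μ := volume) (show s ≤ s + A by linarith)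
    (intervalIntegrable_const (c := nearest P (z + s • u) - A)) (hc.intervalIntegrable _ _) ?_
  · rw [intervalIntegral.integral_const, add_sub_cancel_left, smul_eq_mul] at this
    linarith
  · intro x hx
    have a := nearest_le_add P (z + s • u) (z + x • u)
    rw [dist_add_left, dist_eq_norm, ← sub_smul, norm_smul, hu, mul_one, Real.norm_eq_abs,
      abs_sub_comm, abs_of_nonneg (sub_nonneg.2 hx.1)] at a
    linarith [hx.2]

theorem hasWalk_rounding_line {P : Finset (EuclideanSpace ℝ (Fin d))}
    {S G : Set (EuclideanSpace ℝ (Fin d))} {h δ C₂ A : ℝ} {σ : 𝔼 → 𝔼}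
    (hσ : IsRounding P S G h σ) (h0 : 0 < h) (h1 : h ≤ 93 / 200) (hδ : δ ^ (2 / 3 : ℝ) = h ^ 2)
    (hC : 8 ≤ C₂) {z u : 𝔼} (hu : ‖u‖ = 1) (hN : 0 < nearest P z)
    (hA : h ^ 2 * nearest P z ≤ A) (hA' : A ≤ 2 * h ^ 2 * nearest P z) (k : ℕ)
    (hk : k * A ≤ h * nearest P z / 2) (hG : ∀ x, 0 ≤ x → x ≤ k * A → z + x • u ∈ G) :
    HasWalk P S δ C₂ (σ z) (σ (z + ((k : ℝ) * A) • u))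
      ((∫ x in (0 : ℝ)..(k * A), nearest P (z + x • u)) +
        (nearest P (z + ((k : ℝ) * A) • u) *
          ⟪u, σ (z + ((k : ℝ) * A) • u) - (z + ((k : ℝ) * A) • u)⟫ -
        nearest P z * ⟪u, σ z - z⟫) + 28 * h ^ 2 * nearest P z * (k * A)) := by
  have hA0 : 0 < A := lt_of_lt_of_le (by positivity) hA
  set N := nearest P z with hNdef
  have hnear : ∀ x, 0 ≤ x → x ≤ h * N / 2 → N - h * N / 2 ≤ nearest P (z + x • u) ∧
      nearest P (z + x • u) ≤ N + h * N / 2 := by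
    intro x hx hx'
    have hd : dist (z + x • u) z = x := by
      rw [dist_self_add_left, norm_smul, hu, mul_one, Real.norm_eq_abs, abs_of_nonneg hx]
    have a := nearest_le_add P (z + x • u) z
    have b := nearest_le_add P z (z + x • u)
    rw [hd] at a
    rw [dist_comm, hd] at b
    exact ⟨by linarith, by linarith⟩
  induction k with
  | zero =>
    have hz : z ∈ G := by simpa using hG 0 le_rfl (by simp)
    simpa [hNdef] using HasWalk.refl (P := P) (δ := δ) (C₂ := C₂) (hσ z hz).1
  | succ k ih =>
    have e : ((k + 1 : ℕ) : ℝ) * A = k * A + A := by push_cast; ring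
    rw [e] at hk hG ⊢
    have hkA : 0 ≤ (k : ℝ) * A := by positivity
    have i := ih (fun x hx hx' => hG x hx (by linarith)) (by linarith)
    have e2 : z + ((k : ℝ) * A + A) • u = (z + ((k : ℝ) * A) • u) + A • u := by
      rw [add_smul, add_assoc]
    have n1 := hnear (k * A) hkA (by linarith)
    have n2 := hnear (k * A + A) (by linarith) (by linarith)
    have g1 := hG (k * A) hkA (by linarith)
    have g2 := hG (k * A + A) (by linarith) le_rfl
    rw [e2] at n2 g2 ⊢
    have st := hasWalk_rounding_step hσ h0 h1 hδ hC hu g1 g2 hN n1.1 n1.2 n2.2 hA hA'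
    refine (i.trans st).mono ?_
    have hc : Continuous fun x : ℝ => nearest P (z + x • u) :=
      (continuous_nearest P).comp (by fun_prop)
    have hint := intervalIntegral.integral_add_adjacent_intervals
      (hc.intervalIntegrable (μ := volume) 0 (k * A)) (hc.intervalIntegrable (k * A) (k * A + A))
    have hge := integral_nearest_ge P z u hu (s := k * A) hA0.le
    rw [← hint]
    have : A ^ 2 ≤ 2 * h ^ 2 * N * A := by nlinarith
    nlinarith

/-- Along a short segment, the sample carries a walk whose length exceeds the length of the
segment by a third-order term only. -/
theorem hasWalk_rounding_chord {P : Finset (EuclideanSpace ℝ (Fin d))}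
    {S G : Set (EuclideanSpace ℝ (Fin d))} {h δ C₂ : ℝ} {σ : 𝔼 → 𝔼}
    (hσ : IsRounding P S G h σ) (h0 : 0 < h) (h1 : h ≤ 93 / 200) (hδ : δ ^ (2 / 3 : ℝ) = h ^ 2)
    (hC : 8 ≤ C₂) {z a : 𝔼} (hN : 0 < nearest P z) (hd : dist z a ≤ h * nearest P z / 2)
    (hG : segment ℝ z a ⊆ G) :
    HasWalk P S δ C₂ (σ z) (σ a) (chordCost P z a + 19 * h ^ 3 * nearest P z ^ 2) := by
  have hzG : z ∈ G := hG (left_mem_segment ℝ z a)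
  have haG : a ∈ G := hG (right_mem_segment ℝ z a)
  by_cases hza : dist z a = 0
  · rw [dist_eq_zero] at hza
    subst hza
    refine (HasWalk.refl (hσ z hzG).1).mono ?_
    rw [chordCost, dist_self, mul_zero, zero_add]
    positivity
  set N := nearest P z with hNdef
  set ℓ := dist z a with hℓdef
  have hℓ : 0 < ℓ := lt_of_le_of_ne dist_nonneg (Ne.symm hza)
  set u := ℓ⁻¹ • (a - z) with hudef
  have hu : ‖u‖ = 1 := by
    rw [hudef, norm_smul, ← dist_eq_norm, dist_comm, ← hℓdef, norm_inv, Real.norm_eq_abs,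
      abs_of_pos hℓ, inv_mul_cancel₀ hℓ.ne']
  have ha : a = z + ℓ • u := by
    rw [hudef, smul_smul, mul_inv_cancel₀ hℓ.ne', one_smul]
    abel
  have hG' : ∀ x, 0 ≤ x → x ≤ ℓ → z + x • u ∈ G := by
    intro x hx hx'
    refine hG ?_
    rw [segment_eq_image']
    refine ⟨x / ℓ, ⟨by positivity, (div_le_one hℓ).2 hx'⟩, ?_⟩
    simp only [hudef, smul_smul]
    rw [div_eq_mul_inv]
  have hcc := chordCost_eq_integral P hℓ.le hu ha
  have hNa : nearest P a ≤ N + h * N / 2 := by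
    have := nearest_le_add P a z
    rw [dist_comm] at this
    linarith
  have ez := dist_rounding_le hσ h0 h1 hzG hN.le (by nlinarith : N ≤ N + h * N / 2)
  have ea := dist_rounding_le hσ h0 h1 haG hN.le hNa
  have hh4 : 0 < h ^ 3 * N ^ 2 := by positivity
  rcases lt_or_ge ℓ (h ^ 2 * N) with hs | hs
  · refine (hasWalk_rounding_of_dist_le hσ h0 h1 hδ hC hzG haG hN (by nlinarith) (by nlinarith) hNa
      (by nlinarith)).mono ?_
    have hge := integral_nearest_ge P z u hu (s := 0) hℓ.le
    rw [zero_smul, add_zero, zero_add, ← hcc] at hge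
    have hv : dist (σ z) (σ a) ≤ ℓ + 4 * h ^ 3 * N := by
      have b := dist_triangle4 (σ z) z a (σ a)
      rw [dist_comm a (σ a)] at b
      linarith
    have h5 : dist (σ z) (σ a) ≤ 3 * h ^ 2 * N := by
      have : 0 < h ^ 2 * N := by positivity
      nlinarith
    have b1 : N * dist (σ z) (σ a) ≤ N * (ℓ + 4 * h ^ 3 * N) :=
      mul_le_mul_of_nonneg_left hv hN.le
    have b2 : 5 * h ^ 2 * N * dist (σ z) (σ a) ≤ 5 * h ^ 2 * N * (3 * h ^ 2 * N) :=
      mul_le_mul_of_nonneg_left h5 (by positivity)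
    have b3 : ℓ ^ 2 ≤ (h ^ 2 * N) ^ 2 := pow_le_pow_left₀ hℓ.le hs.le 2
    have b4 : h * (h ^ 3 * N ^ 2) ≤ 93 / 200 * (h ^ 3 * N ^ 2) :=
      mul_le_mul_of_nonneg_right h1 hh4.le
    nlinarith
  · have hq : 0 < h ^ 2 * N := by positivity
    -- Equal pieces with this count have length between `h² N` and `2 h² N`, because `k ≥ 1`.
    set k := ⌊ℓ / (h ^ 2 * N)⌋₊ with hkdef
    have hk1 : 1 ≤ k := by
      rw [hkdef]
      exact (Nat.one_le_floor_iff _).2 ((one_le_div hq).2 hs)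
    have hk1' : (1 : ℝ) ≤ k := by exact_mod_cast hk1
    have hk0 : (0 : ℝ) < k := by linarith
    have hkle : (k : ℝ) * (h ^ 2 * N) ≤ ℓ :=
      (le_div_iff₀ hq).1 (Nat.floor_le (by positivity))
    have hklt : ℓ < ((k : ℝ) + 1) * (h ^ 2 * N) := (div_lt_iff₀ hq).1 (Nat.lt_floor_add_one _)
    have hkA : (k : ℝ) * (ℓ / k) = ℓ := mul_div_cancel₀ _ hk0.ne'
    have st := hasWalk_rounding_line hσ h0 h1 hδ hC hu hN (A := ℓ / k)
      ((le_div_iff₀ hk0).2 (by linarith)) ((div_le_iff₀ hk0).2 (by nlinarith)) k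
      (by rw [hkA]; exact hd) (by rw [hkA]; exact hG')
    rw [hkA, ← hcc, ← ha] at st
    refine st.mono ?_
    have i1 : nearest P a * ⟪u, σ a - a⟫ ≤ 5 / 4 * N * (2 * h ^ 3 * N) := by
      have c1 : ⟪u, σ a - a⟫ ≤ 2 * h ^ 3 * N := by
        refine (real_inner_le_norm _ _).trans ?_
        rw [hu, one_mul, ← dist_eq_norm]
        exact ea
      refine (mul_le_mul_of_nonneg_left c1 (nearest_nonneg P a)).trans ?_
      exact mul_le_mul_of_nonneg_right (by nlinarith) (by positivity)
    have i2 : -(2 * h ^ 3 * N) ≤ ⟪u, σ z - z⟫ := by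
      refine neg_le_of_abs_le ((abs_real_inner_le_norm _ _).trans ?_)
      rw [hu, one_mul, ← dist_eq_norm]
      exact ez
    have i3 := mul_le_mul_of_nonneg_left i2 hN.le
    have i4 : 28 * h ^ 2 * N * ℓ ≤ 28 * h ^ 2 * N * (h * N / 2) :=
      mul_le_mul_of_nonneg_left hd (by positivity)
    nlinarith

/-! ### Rounding to the sample -/

theorem notMem_of_mem_sampleDomain {P : Finset 𝔼} {δ : ℝ} {B : Set 𝔼} {z : 𝔼}
    (hz : z ∈ sampleDomain P δ B) : z ∉ P := fun hP =>
  hz.2 (mem_biUnion hP (Metric.mem_closedEBall_self))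

/-- The distance to `S` need not be attained; the factor `3/2` leaves room to choose a point. -/
theorem exists_isRounding {P : Finset 𝔼} (hP : P.Nonempty) {δ h : ℝ} (h0 : 0 < h)
    (hδ : δ = h ^ 3) {B S : Set 𝔼} (hS : IsDeltaSample P δ (sampleDomain P δ B) S) :
    ∃ σ, IsRounding P S (sampleDomain P δ B) h σ := by
  have hex : ∀ w : 𝔼, ∃ s, w ∈ sampleDomain P δ B →
      s ∈ S ∧ dist s w ≤ 3 / 2 * h ^ 3 * nearest P w := by
    intro w
    by_cases hw : w ∈ sampleDomain P δ B
    · have hwP := notMem_of_mem_sampleDomain hw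
      have hN := nearest_pos hP hwP
      have h3 : 0 < h ^ 3 * nearest P w := by positivity
      have hlt : Metric.infEDist w S < ENNReal.ofReal (3 / 2 * h ^ 3 * nearest P w) := by
        refine (hS.2 w hw hwP).trans_lt ?_
        rw [hδ, ENNReal.ofReal_lt_ofReal_iff_of_nonneg h3.le]
        linarith
      obtain ⟨s, hs, hd⟩ := Metric.infEDist_lt_iff.1 hlt
      refine ⟨s, fun _ => ⟨hs, ?_⟩⟩
      rw [dist_comm]
      rw [edist_dist] at hd
      exact ((ENNReal.ofReal_lt_ofReal_iff_of_nonneg dist_nonneg).1 hd).le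
    · exact ⟨w, fun h => absurd h hw⟩
  choose σ hσ using hex
  exact ⟨σ, fun w hw => hσ w hw⟩

/-! ### The region outside of the slightly shrunken in-balls -/

/-- A radius between the radius of the shrunken ball of `p` and that of its in-ball. -/
def midRad (P : Finset 𝔼) (h : ℝ) (p : 𝔼) : ℝ := (1 - 3 / 4 * h ^ 2) * rad P p

/-- The points of `B` outside of the open balls of radius `midRad P h p` about the sites `p`. -/
def freeRegion (P : Finset 𝔼) (B : Set 𝔼) (h : ℝ) : Set 𝔼 :=
  {z | z ∈ B ∧ ∀ p ∈ P, midRad P h p ≤ dist z p}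

/-- The data of the upper bound: `P` has at least two points, and `δ = h ^ 3` is small. -/
structure Setting (P : Finset (EuclideanSpace ℝ (Fin d))) (h δ : ℝ) : Prop where
  nontrivial : (P : Set (EuclideanSpace ℝ (Fin d))).Nontrivial
  pos : 0 < h
  le : h ≤ 93 / 200
  rpow : δ ^ (2 / 3 : ℝ) = h ^ 2

namespace Setting

variable {P : Finset (EuclideanSpace ℝ (Fin d))} {h δ C₂ : ℝ}
  {S B : Set (EuclideanSpace ℝ (Fin d))}

theorem sq_le (H : Setting P h δ) : h ^ 2 ≤ 1 / 4 := by nlinarith [H.pos, H.le]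

theorem rad_pos (H : Setting P h δ) (p : 𝔼) : 0 < rad P p := by
  obtain ⟨q, hq, hqp⟩ := H.nontrivial.exists_ne p
  exact NNMetric.rad_pos (Finset.mem_coe.1 hq) hqp

theorem inBall_eq (H : Setting P h δ) (p : 𝔼) : inBall P p = Metric.closedBall p (rad P p) := by
  obtain ⟨q, hq, hqp⟩ := H.nontrivial.exists_ne p
  exact NNMetric.inBall_eq (Finset.mem_coe.1 hq) hqp

theorem shrunkBall_eq (H : Setting P h δ) (p : 𝔼) :
    shrunkBall P δ p = Metric.closedBall p ((1 - h ^ 2) * rad P p) := by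
  obtain ⟨q, hq, hqp⟩ := H.nontrivial.exists_ne p
  rw [NNMetric.shrunkBall_eq (by rw [H.rpow]; linarith [H.sq_le]) (Finset.mem_coe.1 hq) hqp, H.rpow]

theorem midRad_pos (H : Setting P h δ) (p : 𝔼) : 0 < midRad P h p :=
  mul_pos (by linarith [H.sq_le]) (H.rad_pos p)

theorem midRad_le (H : Setting P h δ) (p : 𝔼) : midRad P h p ≤ rad P p := by
  have := H.rad_pos p
  rw [midRad]
  nlinarith [sq_nonneg h]

theorem nearest_eq_midRad (H : Setting P h δ) {p a : 𝔼} (hp : p ∈ P)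
    (ha : dist a p = midRad P h p) : nearest P a = midRad P h p :=
  (nearest_eq_dist hp (ha.le.trans (H.midRad_le p))).trans ha

/-- In-balls of distinct sites overlap at most in their boundaries, so the sphere about one site
avoids the open balls about the others. -/
theorem mem_freeRegion (H : Setting P h δ) {p a : 𝔼} (hp : p ∈ P)
    (ha : dist a p = midRad P h p) (haB : a ∈ B) : a ∈ freeRegion P B h := by
  refine ⟨haB, fun q hq => ?_⟩
  by_cases hqp : q = p
  · rw [hqp, ha]
  · have h1 := two_mul_rad_le hp (Ne.symm hqp)
    have h2 := two_mul_rad_le hq hqp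
    have h3 := dist_triangle_left p q a
    rw [dist_comm q p] at h1
    linarith [H.midRad_le p, H.midRad_le q]

theorem exists_pos_le_nearest (H : Setting P h δ) :
    ∃ μ > 0, ∀ w ∈ freeRegion P B h, μ ≤ nearest P w := by
  have hne : P.Nonempty := Finset.coe_nonempty.1 H.nontrivial.nonempty
  obtain ⟨q, hq, hmin⟩ := P.exists_min_image (midRad P h) hne
  refine ⟨midRad P h q, H.midRad_pos q, fun w hw => ?_⟩
  obtain ⟨p, hp, e⟩ := exists_nearest_eq_dist hne w
  rw [e]
  exact (hmin p hp).trans (hw.2 p hp)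

/-- Short segments between points of the free region avoid the shrunken balls. -/
theorem segment_subset (H : Setting P h δ) (hB : Convex ℝ B) {z a : 𝔼}
    (hz : z ∈ freeRegion P B h) (ha : a ∈ freeRegion P B h)
    (hd : dist z a ≤ h * nearest P z / 2) : segment ℝ z a ⊆ sampleDomain P δ B := by
  intro w hw
  refine ⟨hB.segment_subset hz.1 ha.1 hw, fun hmem => ?_⟩
  obtain ⟨p, hp, hwp⟩ := mem_iUnion₂.1 hmem
  rw [H.shrunkBall_eq, Metric.mem_closedBall] at hwp
  set r := rad P p with hr
  have hr0 : 0 < r := H.rad_pos p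
  have hzw : dist z w ≤ dist z a := by
    have := dist_add_dist_of_mem_segment hw
    linarith [dist_nonneg (x := w) (y := a)]
  have hNz : nearest P z * (1 - h / 2) ≤ r := by
    have h1 := nearest_le_dist hp z
    have h2 := dist_triangle z w p
    nlinarith [sq_nonneg h]
  have hNz2 : nearest P z ≤ 4 / 3 * r := by
    have := nearest_nonneg P z
    nlinarith [H.le]
  obtain ⟨s, t, hs, ht, hst, rfl⟩ := hw
  have hz2 := hz.2 p hp
  have ha2 := ha.2 p hp
  rw [midRad, ← hr, dist_eq_norm] at hz2 ha2
  rw [dist_eq_norm] at hwp hd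
  have hm0 : 0 ≤ (1 - 3 / 4 * h ^ 2) * r := mul_nonneg (by linarith [H.sq_le]) hr0.le
  have hz3 := pow_le_pow_left₀ hm0 hz2 2
  have ha3 := pow_le_pow_left₀ hm0 ha2 2
  have hw3 := pow_le_pow_left₀ (norm_nonneg _) hwp 2
  -- Stewart's identity. The chord lowers the squared distance to `p` by at most `(h r)² / 9`, less
  -- than the gap between the squares of `(1 - 3/4 h²) r` and `(1 - h²) r`.
  have hstew : ‖s • z + t • a - p‖ ^ 2 =
      s * ‖z - p‖ ^ 2 + t * ‖a - p‖ ^ 2 - s * t * ‖z - a‖ ^ 2 := by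
    have e1 : s • z + t • a - p = s • (z - p) + t • (a - p) := by
      rw [smul_sub, smul_sub, ← add_sub_add_comm, ← add_smul, hst, one_smul]
    have e2 : z - a = (z - p) - (a - p) := by abel
    rw [e1, e2, norm_add_sq_real, norm_sub_sq_real (z - p), norm_smul, norm_smul,
      real_inner_smul_left, real_inner_smul_right, Real.norm_eq_abs, Real.norm_eq_abs, mul_pow,
      mul_pow, sq_abs, sq_abs]
    obtain rfl : s = 1 - t := by linarith
    ring
  have hst4 : s * t ≤ 1 / 4 := by
    obtain rfl : s = 1 - t := by linarith
    nlinarith [sq_nonneg (t - 1 / 2)]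
  have hza : ‖z - a‖ ≤ 2 / 3 * (h * r) := by
    have := mul_le_mul_of_nonneg_left hNz2 H.pos.le
    linarith
  have hza2 := pow_le_pow_left₀ (norm_nonneg _) hza 2
  have h4 : s * t * ‖z - a‖ ^ 2 ≤ 1 / 4 * (2 / 3 * (h * r)) ^ 2 :=
    mul_le_mul hst4 hza2 (by positivity) (by norm_num)
  have h5 : ((1 - 3 / 4 * h ^ 2) * r) ^ 2 ≤ s * ‖z - p‖ ^ 2 + t * ‖a - p‖ ^ 2 := by
    have := mul_le_mul_of_nonneg_left hz3 hs
    have := mul_le_mul_of_nonneg_left ha3 ht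
    obtain rfl : s = 1 - t := by linarith
    linarith
  have h6 : 0 < (h * r) ^ 2 := by have := H.pos; positivity
  have h7 : (h * r) ^ 2 * h ^ 2 ≤ (h * r) ^ 2 * (1 / 4) :=
    mul_le_mul_of_nonneg_left H.sq_le h6.le
  nlinarith

theorem mem_sampleDomain (H : Setting P h δ) (hB : Convex ℝ B) {z : 𝔼}
    (hz : z ∈ freeRegion P B h) : z ∈ sampleDomain P δ B := by
  refine H.segment_subset hB hz hz ?_ (left_mem_segment ℝ z z)
  rw [dist_self]
  have := nearest_nonneg P z
  have := H.pos
  positivity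

/-! ### Entering and leaving in-balls -/

/-- The margin `3/4 h² r` between `midRad` and the in-radius absorbs the rounding displacement,
since `h ≤ 1/2` gives `3/2 h³ ≤ 3/4 h²`. -/
theorem rounding_mem_inBall (H : Setting P h δ) (hB : Convex ℝ B) {σ : 𝔼 → 𝔼}
    (hσ : IsRounding P S (sampleDomain P δ B) h σ) {p a : 𝔼} (hp : p ∈ P) (haB : a ∈ B)
    (ha : dist a p = midRad P h p) :
    σ a ∈ S ∧ σ a ∈ inBall P p ∧ nnDist P (σ a) a ≤ 2 * h ^ 3 * midRad P h p ^ 2 := by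
  obtain ⟨h1, h2⟩ := hσ a (H.mem_sampleDomain hB (H.mem_freeRegion hp ha haB))
  rw [H.nearest_eq_midRad hp ha] at h2
  set m := midRad P h p with hm
  have hm0 : 0 < m := H.midRad_pos p
  have hp3 : 0 < h ^ 3 := pow_pos H.pos 3
  have h33 : h ^ 3 ≤ 1 / 9 := by
    have := pow_le_pow_left₀ H.pos.le H.le 3
    norm_num at this
    linarith
  refine ⟨h1, ?_, ?_⟩
  · rw [H.inBall_eq, Metric.mem_closedBall]
    have hr := H.rad_pos p
    have hs : 3 / 2 * h ^ 3 ≤ 3 / 4 * h ^ 2 := by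
      nlinarith [H.le, sq_nonneg h]
    have := dist_triangle (σ a) a p
    have hmr : (1 + 3 / 4 * h ^ 2) * m ≤ rad P p := by
      rw [hm, midRad]
      have : 0 ≤ (h ^ 2) ^ 2 * rad P p := by positivity
      nlinarith
    nlinarith
  · have hseg := nnDist_le_segment P (σ a) a
    have hn := nearest_le_add P (σ a) a
    rw [H.nearest_eq_midRad hp ha, ← hm] at hseg hn
    set l := dist (σ a) a with hl
    have hl0 : 0 ≤ l := dist_nonneg
    have hl1 : l ≤ 1 / 6 * m := by nlinarith
    have hmax : max (nearest P (σ a)) m ≤ m + l := max_le hn (by linarith)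
    calc nnDist P (σ a) a ≤ (max (nearest P (σ a)) m + l / 2) * l := hseg
      _ ≤ (4 / 3 * m) * l := mul_le_mul_of_nonneg_right (by linarith) hl0
      _ ≤ (4 / 3 * m) * (3 / 2 * h ^ 3 * m) := mul_le_mul_of_nonneg_left h2 (by positivity)
      _ = 2 * h ^ 3 * m ^ 2 := by ring

theorem site_notMem (hS : S ⊆ sampleDomain P δ B) : ∀ q ∈ P, q ∉ S := fun _ hq hqS =>
  notMem_of_mem_sampleDomain (hS hqS) hq

/-- The edge has exact weight, so the path may do anything between `s` and `t`, even leave the ball.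
-/
theorem hasWalk_inBall (H : Setting P h δ) (hB : Convex ℝ B) {σ : 𝔼 → 𝔼}
    (hσ : IsRounding P S (sampleDomain P δ B) h σ) {K : ℝ≥0} {γ : ℝ → 𝔼} (hγ : LipschitzWith K γ)
    (hγB : ∀ u, γ u ∈ B) {p : 𝔼} (hp : p ∈ P) {s t : ℝ} (hst : s ≤ t)
    (hs : dist (γ s) p = midRad P h p) (ht : dist (γ t) p = midRad P h p) :
    HasWalk P S δ C₂ (σ (γ s)) (σ (γ t)) (cost P γ s t + 4 * h ^ 3 * midRad P h p ^ 2) := by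
  obtain ⟨a1, a2, a3⟩ := H.rounding_mem_inBall hB hσ hp (hγB s) hs
  obtain ⟨b1, b2, b3⟩ := H.rounding_mem_inBall hB hσ hp (hγB t) ht
  refine (HasWalk.of_inBall hp a1 b1 a2 b2).mono ?_
  have t1 := nnDist_triangle P (σ (γ s)) (γ s) (σ (γ t))
  have t2 := nnDist_triangle P (γ s) (γ t) (σ (γ t))
  rw [nnDist_comm P (γ t)] at t2
  linarith [nnDist_le_cost P hγ hst]

theorem hasWalk_site (H : Setting P h δ) (hB : Convex ℝ B) {σ : 𝔼 → 𝔼}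
    (hσ : IsRounding P S (sampleDomain P δ B) h σ) (hS : S ⊆ sampleDomain P δ B)
    {a p : 𝔼} (hp : p ∈ P) (haB : a ∈ B) (ha : dist a p = midRad P h p) :
    HasWalk P S δ C₂ p (σ a) (nnDist P p a + 2 * h ^ 3 * midRad P h p ^ 2) := by
  obtain ⟨a1, a2, a3⟩ := H.rounding_mem_inBall hB hσ hp haB ha
  refine (HasWalk.of_site (site_notMem hS) hp a1 a2).mono ?_
  have t1 := nnDist_triangle P p a (σ a)
  rw [nnDist_comm P a] at t1
  linarith

/-! ### Following a path through the sample -/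

theorem exists_first_exit (H : Setting P h δ) {K : ℝ≥0} {γ : ℝ → 𝔼} (hγ : LipschitzWith K γ)
    {s : ℝ} (hs : s ≤ 1) (hy : γ 1 ∈ P) :
    ∃ T ∈ Icc s 1, dist (γ T) (γ s) = h * nearest P (γ s) / 2 ∧
      (∀ u ∈ Icc s T, dist (γ u) (γ s) ≤ h * nearest P (γ s) / 2) ∧
      3 / 8 * h * nearest P (γ s) ^ 2 ≤ cost P γ s T := by
  have hN := nearest_nonneg P (γ s)
  have h0 := H.pos
  have h1 := H.le
  set N := nearest P (γ s) with hNdef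
  set ρ := h * N / 2 with hρ
  have hρ0 : 0 ≤ ρ := by positivity
  set D : ℝ → ℝ := fun u => dist (γ u) (γ s) with hD
  have hDc : Continuous D := hγ.continuous.dist continuous_const
  have hDs : D s = 0 := dist_self _
  have hA : IsCompact (Icc s 1 ∩ {u | ρ ≤ D u}) :=
    isCompact_Icc.inter_right (isClosed_le continuous_const hDc)
  -- The path ends at a site, at distance at least `N` from `γ s`, so it must leave the ball of
  -- radius `ρ`.
  have h1mem : (1 : ℝ) ∈ Icc s 1 ∩ {u | ρ ≤ D u} := by
    refine ⟨⟨hs, le_rfl⟩, ?_⟩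
    have := nearest_le_dist hy (γ s)
    rw [dist_comm] at this
    simp only [hD, mem_ofPred_eq]
    nlinarith
  obtain ⟨T, ⟨hT, hρT⟩, hleast⟩ := hA.exists_isLeast ⟨1, h1mem⟩
  have hlt : ∀ u ∈ Ico s T, D u < ρ := by
    intro u hu
    by_contra hcon
    push Not at hcon
    exact absurd (hleast ⟨⟨hu.1, hu.2.le.trans hT.2⟩, hcon⟩) (not_le.2 hu.2)
  have hTeq : D T = ρ := by
    obtain ⟨u, hu, hue⟩ := intermediate_value_Icc hT.1 hDc.continuousOn
      (show ρ ∈ Icc (D s) (D T) from ⟨by rw [hDs]; exact hρ0, hρT⟩)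
    rcases hu.2.lt_or_eq with hlt' | heq
    · exact absurd hue (hlt u ⟨hu.1, hlt'⟩).ne
    · rw [← heq, hue]
  have hstay : ∀ u ∈ Icc s T, D u ≤ ρ := by
    intro u hu
    rcases hu.2.lt_or_eq with hlt' | heq
    · exact (hlt u ⟨hu.1, hlt'⟩).le
    · rw [heq, hTeq]
  refine ⟨T, hT, hTeq, hstay, ?_⟩
  have hc := mul_dist_le_cost P hγ hT.1 (c := 3 / 4 * N) (by positivity) fun u hu => by
    have h2 := nearest_le_add P (γ s) (γ u)
    have h3 := hstay u hu
    simp only [hD] at h3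
    rw [dist_comm] at h2
    nlinarith
  rw [dist_comm] at hc
  have : dist (γ T) (γ s) = ρ := hTeq
  rw [this] at hc
  calc 3 / 8 * h * N ^ 2 = 3 / 4 * N * ρ := by rw [hρ]; ring
    _ ≤ _ := hc

theorem hasWalk_chord (H : Setting P h δ) (hB : Convex ℝ B) (hC : 8 ≤ C₂) {σ : 𝔼 → 𝔼}
    (hσ : IsRounding P S (sampleDomain P δ B) h σ) {K : ℝ≥0} {γ : ℝ → 𝔼} (hγ : LipschitzWith K γ)
    {s t : ℝ} (hst : s ≤ t) (hs : γ s ∈ freeRegion P B h) (ht : γ t ∈ freeRegion P B h)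
    (hstay : ∀ u ∈ Icc s t, dist (γ u) (γ s) ≤ h * nearest P (γ s) / 2) :
    HasWalk P S δ C₂ (σ (γ s)) (σ (γ t)) (cost P γ s t + 20 * h ^ 3 * nearest P (γ s) ^ 2) := by
  have hN : 0 < nearest P (γ s) := by
    obtain ⟨μ, hμ, hle⟩ := H.exists_pos_le_nearest (B := B)
    exact hμ.trans_le (hle _ hs)
  have hd := hstay t ⟨hst, le_rfl⟩
  rw [dist_comm] at hd
  refine (hasWalk_rounding_chord hσ H.pos H.le H.rpow hC hN hd
    (H.segment_subset hB hs ht hd)).mono ?_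
  have hc := chordCost_le_cost P hγ hst hN (by nlinarith [H.le]) hstay
  have e : 8 * (h * nearest P (γ s) / 2) ^ 3 / nearest P (γ s) = h ^ 3 * nearest P (γ s) ^ 2 := by
    field_simp
    ring
  rw [e] at hc
  linarith

/-- If the first exit point is in the free region, follow the chord to it. Otherwise it lies in some
ball of radius `midRad`: follow the chord to an earlier crossing of the sphere, then jump to a later
crossing, or to the site if the path ends in the ball. All errors are charged to the path up to `T`,
even if the chord itself is short. -/
theorem exists_step (H : Setting P h δ) (hB : Convex ℝ B) (hC : 8 ≤ C₂) {σ : 𝔼 → 𝔼}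
    (hσ : IsRounding P S (sampleDomain P δ B) h σ) (hS : S ⊆ sampleDomain P δ B) {K : ℝ≥0}
    {γ : ℝ → 𝔼} (hγ : LipschitzWith K γ) (hγB : ∀ u, γ u ∈ B) (hy : γ 1 ∈ P) {s : ℝ} (hs1 : s ≤ 1)
    (hs : γ s ∈ freeRegion P B h) :
    HasWalk P S δ C₂ (σ (γ s)) (γ 1) ((1 + 80 * h ^ 2) * cost P γ s 1) ∨
      ∃ t ∈ Icc s 1, γ t ∈ freeRegion P B h ∧ h * nearest P (γ s) / 2 ≤ K * (t - s) ∧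
        HasWalk P S δ C₂ (σ (γ s)) (σ (γ t)) ((1 + 80 * h ^ 2) * cost P γ s t) := by
  obtain ⟨T, hT, hTd, hstay, hcost⟩ := H.exists_first_exit hγ hs1 hy
  set N := nearest P (γ s) with hN
  have hh2 : 0 < h ^ 2 := pow_pos H.pos 2
  have hKT : h * N / 2 ≤ K * (T - s) := by
    have := hγ.dist_le_mul T s
    rwa [hTd, Real.dist_eq, abs_of_nonneg (sub_nonneg.2 hT.1)] at this
  -- The chord loses 20 and a jump at most `4 * (5/4)² < 7`, in units of `h³ N²`.
  have herr : 27 * h ^ 3 * N ^ 2 ≤ 80 * h ^ 2 * cost P γ s T := by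
    have := mul_le_mul_of_nonneg_left hcost (show 0 ≤ 72 * h ^ 2 by positivity)
    have := mul_nonneg hh2.le (cost_nonneg P γ hT.1)
    nlinarith
  have herr' : ∀ t, T ≤ t → 27 * h ^ 3 * N ^ 2 ≤ 80 * h ^ 2 * cost P γ s t := by
    intro t ht
    have h1 := cost_add_cost P hγ s T t
    have h2 := mul_nonneg (show 0 ≤ 80 * h ^ 2 by positivity) (cost_nonneg P γ ht)
    rw [← h1]
    linarith
  have hpos : 0 ≤ h ^ 3 * N ^ 2 := by
    have := H.pos
    positivity
  by_cases hTF : γ T ∈ freeRegion P B h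
  · right
    refine ⟨T, hT, hTF, hKT, (H.hasWalk_chord hB hC hσ hγ hT.1 hs hTF hstay).mono ?_⟩
    linarith
  obtain ⟨p, hp, hpT⟩ : ∃ p ∈ P, dist (γ T) p < midRad P h p := by
    by_contra hcon
    push Not at hcon
    exact hTF ⟨hγB T, hcon⟩
  have hDc : Continuous fun u => dist (γ u) p := hγ.continuous.dist continuous_const
  obtain ⟨α, hα, hαp⟩ := intermediate_value_Icc' hT.1 hDc.continuousOn
    (show midRad P h p ∈ Icc (dist (γ T) p) (dist (γ s) p) from ⟨hpT.le, hs.2 p hp⟩)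
  have hαp' : dist (γ α) p = midRad P h p := hαp
  have hαF := H.mem_freeRegion hp hαp' (hγB α)
  have hchord := H.hasWalk_chord hB hC hσ hγ hα.1 hs hαF
    fun u hu => hstay u ⟨hu.1, hu.2.trans hα.2⟩
  have hm : midRad P h p ≤ 5 / 4 * N := by
    rw [← H.nearest_eq_midRad hp hαp']
    have h1 := nearest_le_add P (γ α) (γ s)
    have h2 := hstay α hα
    have h3 : h * N ≤ 1 / 2 * N :=
      mul_le_mul_of_nonneg_right (by linarith [H.le]) (nearest_nonneg P _)
    linarith
  have hm2 : h ^ 3 * midRad P h p ^ 2 ≤ h ^ 3 * (5 / 4 * N) ^ 2 :=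
    mul_le_mul_of_nonneg_left (pow_le_pow_left₀ (H.midRad_pos p).le hm 2) (pow_nonneg H.pos.le 3)
  by_cases hyp : midRad P h p ≤ dist (γ 1) p
  · obtain ⟨β, hβ, hβp⟩ := intermediate_value_Icc hT.2 hDc.continuousOn
      (show midRad P h p ∈ Icc (dist (γ T) p) (dist (γ 1) p) from ⟨hpT.le, hyp⟩)
    have hβp' : dist (γ β) p = midRad P h p := hβp
    right
    refine ⟨β, ⟨hT.1.trans hβ.1, hβ.2⟩, H.mem_freeRegion hp hβp' (hγB β), ?_, ?_⟩
    · refine hKT.trans (mul_le_mul_of_nonneg_left ?_ K.2)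
      linarith [hβ.1]
    · have hjump := H.hasWalk_inBall (C₂ := C₂) hB hσ hγ hγB hp (hα.2.trans hβ.1) hαp' hβp'
      refine (hchord.trans hjump).mono ?_
      have := cost_add_cost P hγ s α β
      have := herr' β hβ.1
      linarith
  · have hyp' : γ 1 = p := by
      by_contra hne
      have h1 := two_mul_rad_le hy hne
      rw [dist_comm] at h1
      have := H.midRad_le p
      have := H.rad_pos p
      linarith
    left
    have hend := (H.hasWalk_site (C₂ := C₂) hB hσ hS hp (hγB α) hαp').symm
    rw [hyp']
    refine (hchord.trans hend).mono ?_
    have h1 := nnDist_le_cost P hγ (hα.2.trans hT.2)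
    rw [hyp', nnDist_comm] at h1
    have := cost_add_cost P hγ s α 1
    have := herr' 1 hT.2
    linarith

theorem hasWalk_of_mem_freeRegion (H : Setting P h δ) (hB : Convex ℝ B) (hC : 8 ≤ C₂) {σ : 𝔼 → 𝔼}
    (hσ : IsRounding P S (sampleDomain P δ B) h σ) (hS : S ⊆ sampleDomain P δ B) {K : ℝ≥0}
    {γ : ℝ → 𝔼} (hγ : LipschitzWith K γ) (hγB : ∀ u, γ u ∈ B) (hy : γ 1 ∈ P) {s : ℝ} (hs1 : s ≤ 1)
    (hs : γ s ∈ freeRegion P B h) :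
    HasWalk P S δ C₂ (σ (γ s)) (γ 1) ((1 + 80 * h ^ 2) * cost P γ s 1) := by
  obtain ⟨μ, hμ, hle⟩ := H.exists_pos_le_nearest (B := B)
  have h0 := H.pos
  -- Each step advances the time by at least `τ`, so finitely many suffice; `K + 1` guards against
  -- `K = 0`.
  set τ := h * μ / 2 / (K + 1) with hτdef
  have hK : (0 : ℝ) < K + 1 := by positivity
  have hτ : 0 < τ := by positivity
  obtain ⟨n, hn⟩ : ∃ n : ℕ, 1 - s ≤ n * τ := by
    obtain ⟨n, hn⟩ := exists_nat_ge ((1 - s) / τ)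
    exact ⟨n, (div_le_iff₀ hτ).1 hn⟩
  induction n generalizing s with
  | zero =>
    exfalso
    obtain rfl : s = 1 := by
      refine le_antisymm hs1 ?_
      simpa using hn
    have := hs.2 _ hy
    rw [dist_self] at this
    exact absurd this (not_le.2 (H.midRad_pos _))
  | succ n ih =>
    rcases H.exists_step hB hC hσ hS hγ hγB hy hs1 hs with hw | ⟨t, ht, htF, hKt, hw⟩
    · exact hw
    · have hstep : τ ≤ t - s := by
        rw [hτdef, div_le_iff₀ hK]
        have h1 := mul_le_mul_of_nonneg_left (hle _ hs) h0.le
        have h2 := sub_nonneg.2 ht.1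
        nlinarith
      refine (hw.trans (ih ht.2 htF ?_)).mono (le_of_eq ?_)
      · push_cast at hn
        linarith
      · rw [← mul_add, cost_add_cost P hγ]

/-- Every path in `B` between two sites is accompanied by a walk of almost the same length. -/
theorem hasWalk_of_path (H : Setting P h δ) (hB : Convex ℝ B) (hC : 8 ≤ C₂) (hδ : δ = h ^ 3)
    (hS : IsDeltaSample P δ (sampleDomain P δ B) S) {K : ℝ≥0} {γ : ℝ → 𝔼} (hγ : LipschitzWith K γ)
    (hγB : ∀ u, γ u ∈ B) (hx : γ 0 ∈ P) (hy : γ 1 ∈ P) (hxy : γ 0 ≠ γ 1) :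
    HasWalk P S δ C₂ (γ 0) (γ 1) ((1 + 100 * h ^ 2) * cost P γ 0 1) := by
  obtain ⟨σ, hσ⟩ := exists_isRounding ⟨_, hx⟩ H.pos hδ hS
  have hfar : midRad P h (γ 0) ≤ dist (γ 1) (γ 0) := by
    have h1 := two_mul_rad_le hy hxy.symm
    rw [dist_comm] at h1
    linarith [H.midRad_le (γ 0), H.rad_pos (γ 0)]
  have hDc : Continuous fun u => dist (γ u) (γ 0) := hγ.continuous.dist continuous_const
  obtain ⟨t, ht, htm⟩ := intermediate_value_Icc zero_le_one hDc.continuousOn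
    (show midRad P h (γ 0) ∈ Icc (dist (γ 0) (γ 0)) (dist (γ 1) (γ 0)) from
      ⟨by rw [dist_self]; exact (H.midRad_pos _).le, hfar⟩)
  have htm' : dist (γ t) (γ 0) = midRad P h (γ 0) := htm
  have w1 := H.hasWalk_site (C₂ := C₂) hB hσ hS.1 hx (hγB t) htm'
  have w2 := H.hasWalk_of_mem_freeRegion hB hC hσ hS.1 hγ hγB hy ht.2
    (H.mem_freeRegion hx htm' (hγB t))
  refine (w1.trans w2).mono ?_
  -- The error of the initial edge, `2 h³ m²` with `m = midRad P h (γ 0)`, is charged to the path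
  -- after `t`; this raises 80 to at most 100.
  obtain ⟨T, hT, -, -, hcost⟩ := H.exists_first_exit hγ ht.2 hy
  rw [H.nearest_eq_midRad hx htm'] at hcost
  have c1 := nnDist_le_cost P hγ ht.1
  have c2 := cost_add_cost P hγ 0 t 1
  have c3 := cost_add_cost P hγ t T 1
  have c4 := cost_nonneg P γ hT.2
  have c5 := cost_nonneg P γ ht.1
  have hh2 : 0 < h ^ 2 := pow_pos H.pos 2
  have c6 := mul_le_mul_of_nonneg_left (hcost.trans (by linarith : _ ≤ cost P γ t 1)) hh2.le
  have c7 := mul_nonneg hh2.le c5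
  have c8 : 0 ≤ h ^ 3 * midRad P h (γ 0) ^ 2 := mul_nonneg (pow_nonneg H.pos.le 3) (sq_nonneg _)
  rw [← c2]
  nlinarith

end Setting

/-! ### From paths to distances: the upper bound -/

theorem graphDist_le_mul_nnDist {P : Finset 𝔼} {B : ConvexBody 𝔼} {S : Set 𝔼} {δ C₂ : ℝ}
    (hB : (P : Set 𝔼) ⊆ B) (h0 : 0 < δ) (h1 : δ < 1 / 10) (hC : 8 ≤ C₂)
    (hS : IsDeltaSample P δ (sampleDomain P δ B) S) (x y : ↥(S ∪ (P : Set 𝔼)))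
    (hx : (x : 𝔼) ∈ P) (hy : (y : 𝔼) ∈ P) :
    graphDist P S δ C₂ x y ≤ ENNReal.ofReal ((1 + 100 * δ ^ (2 / 3 : ℝ)) * nnDist P x y) := by
  -- This disposes of a single site, whose in-ball is the whole space.
  by_cases hxy : x = y
  · subst hxy
    refine le_trans (iInf_le _ SimpleGraph.Walk.nil) ?_
    simp [walkLength]
  have hxy' : (x : 𝔼) ≠ y := fun e => hxy (Subtype.ext e)
  set h := δ ^ (1 / 3 : ℝ) with hh
  have hpos : 0 < h := Real.rpow_pos_of_pos h0 _
  have hδ : δ = h ^ 3 := by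
    rw [hh, ← Real.rpow_natCast, ← Real.rpow_mul h0.le]
    norm_num
  have hsq : δ ^ (2 / 3 : ℝ) = h ^ 2 := by
    rw [hh, ← Real.rpow_natCast, ← Real.rpow_mul h0.le]
    norm_num
  -- `93/200` lies just above the cube root of `1/10`.
  have hle : h ≤ 93 / 200 := by
    by_contra hcon
    push Not at hcon
    have := pow_le_pow_left₀ (by norm_num) hcon.le 3
    rw [← hδ] at this
    norm_num at this
    linarith
  have H : Setting P h δ := ⟨⟨x, hx, y, hy, hxy'⟩, hpos, hle, hsq⟩
  have key : ∀ ε > 0, graphDist P S δ C₂ x y ≤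
      ENNReal.ofReal ((1 + 100 * h ^ 2) * (nnDist P x y + ε)) := by
    intro ε hε
    obtain ⟨γ, hγ, hlt⟩ := exists_nnLength_lt P (x : 𝔼) y hε
    obtain ⟨K, g, hg, g0, g1, hgB, hc⟩ := exists_path_in_convexBody hB hγ hx hy
    have hw := H.hasWalk_of_path B.convex hC hδ hS hg hgB (by rwa [g0]) (by rwa [g1])
      (by rwa [g0, g1])
    rw [g0, g1] at hw
    refine (graphDist_le hw).trans (ENNReal.ofReal_le_ofReal ?_)
    exact mul_le_mul_of_nonneg_left (hc.trans hlt.le) (by positivity)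
  rw [hsq]
  have hlim : Tendsto (fun ε : ℝ => ENNReal.ofReal ((1 + 100 * h ^ 2) * (nnDist P x y + ε)))
      (𝓝[>] 0) (𝓝 (ENNReal.ofReal ((1 + 100 * h ^ 2) * (nnDist P x y + 0)))) := by
    refine Tendsto.mono_left (Continuous.tendsto ?_ 0) nhdsWithin_le_nhds
    exact ENNReal.continuous_ofReal.comp (by fun_prop)
  rw [add_zero] at hlim
  exact ge_of_tendsto hlim (eventually_nhdsWithin_of_forall fun ε hε => key ε hε)

end NNMetric

end

theorem mainTheorem6 :
    ∃ C₀ C₄ : ℕ, 0 < C₀ ∧ 0 < C₄ ∧ ∀ C₂ : ℝ, (C₀ : ℝ) ≤ C₂ →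
      ∀ (d : ℕ) (P : Finset (EuclideanSpace ℝ (Fin d))) (B : ConvexBody (EuclideanSpace ℝ (Fin d)))
        (δ : ℝ) (S : Set (EuclideanSpace ℝ (Fin d))),
        (P : Set (EuclideanSpace ℝ (Fin d))) ⊆ (B : Set (EuclideanSpace ℝ (Fin d))) →
        0 < δ → δ < 1 / 10 →
        NNMetric.IsDeltaSample P δ
          (NNMetric.sampleDomain P δ (B : Set (EuclideanSpace ℝ (Fin d)))) S →
        ∀ x y : ↥(S ∪ (P : Set (EuclideanSpace ℝ (Fin d)))),
          (x : EuclideanSpace ℝ (Fin d)) ∈ P → (y : EuclideanSpace ℝ (Fin d)) ∈ P →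
          ENNReal.ofReal ((1 - C₂ * δ ^ (2 / 3 : ℝ)) * NNMetric.nnDist P x y) ≤
              NNMetric.graphDist P S δ C₂ x y ∧
            NNMetric.graphDist P S δ C₂ x y ≤
              ENNReal.ofReal ((1 + (C₄ : ℝ) * δ ^ (2 / 3 : ℝ)) * NNMetric.nnDist P x y) := by
  refine ⟨8, 100, by norm_num, by norm_num, fun C₂ hC d P B δ S hB h0 h1 hS x y hx hy => ⟨?_, ?_⟩⟩
  · refine NNMetric.ofReal_mul_nnDist_le_graphDist ?_ x y
    have : (0 : ℝ) ≤ δ ^ (2 / 3 : ℝ) := Real.rpow_nonneg h0.le _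
    push_cast at hC
    exact mul_nonneg (by linarith) this
  · exact_mod_cast NNMetric.graphDist_le_mul_nnDist hB h0 h1 (by exact_mod_cast hC) hS x y hx hy
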